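/- Let $\mu_\sigma$ be a Borel probability measure on $\mathbb{R}$ whose support contains more than one point and is contained in $[0,s_+]$, where $0<s_+<\infty$. Put $$r_-:=\Big(\int x^{-2}\,d\mu_\sigma(x)\Big)^{-1/2},\qquad r_+:=\Big(\int x^{2}\,d\mu_\sigma(x)\Big)^{1/2},$$ where $x^{-2}=\infty$ at $x=0$ and $r_-:=0$ if the first integral diverges; then $r_-<r_+$. For $r\in(r_-,r_+)$ put $$\sigma_-:=\Big(\frac{r^2-r_-^2}{r_+^2-r_-^2}\Big)^{1/2},\qquad \sigma_+:=\Big(\frac{r_+^2}{r_+^2-r^2}\Big)^{1/2}.$$ For a probability measure $\mu$ on $\mathbb{R}$ let $\mu^{\mathrm{sym}}(A):=\frac12(\mu(A)+\mu(-A))$ and, on $\mathbb{C}^+:=\{z:\operatorname{Im}z>0\}$, let $F_\mu(z):=-\big(\int\frac{d\mu(x)}{x-z}\big)^{-1}$. Let $\mu_1:=\mu_\sigma^{\mathrm{sym}}$, $\mu_2:=\delta_r^{\mathrm{sym}}$, and let $\omega_1,\omega_2:\mathbb{C}^+\to\mathbb{C}^+$ be the subordination functions of the free additive convolution $\mu_1\boxplus\mu_2$,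 i.e. the unique analytic functions with $\operatorname{Im}\omega_j(z)\ge\operatorname{Im}z$, $\lim_{\eta\to\infty}\omega_j(i\eta)/(i\eta)=1$ for $j=1,2$, and $$F_{\mu_1}(\omega_2(z))=F_{\mu_2}(\omega_1(z)),\qquad \omega_1(z)+\omega_2(z)-z=F_{\mu_1}(\omega_2(z))\qquad(z\in\mathbb{C}^+).$$ Then $\omega_2$ extends continuously to $0$; write $\omega_2(0)$ for the value of the extension. There is a numerical constant $C_2>1$ (independent of $\mu_\sigma$, $s_+$ and $r$), and for every such $\mu_\sigma$ and every $r\in(r_-,r_+)$ there are constants $b_-=b_-(\mu_1,r)>0$ and $s_-=s_-(\mu_1,r)>0$, depending only on $\mu_1$ and $r$, such that for all $\eta\ge0$ $$C_2^{-1}\,\sigma_-s_-b_-\min\Big\{1,\frac{\sigma_-s_-}{\eta}\Big\}\le|\omega_2(i\eta)-i\eta|\le C_2\min\Big\{\sigma_+s_+,\frac{r^2}{\eta}\Big\},$$ where for $\eta=0$ the quotients by $\eta$ are read as $+\infty$. -/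

import Mathlib

open MeasureTheory Filter Topology

noncomputable section

/-- The open upper half-plane `ℂ⁺`, as a subset of `ℂ`. -/
def upperHalf : Set ℂ := {z : ℂ | 0 < z.im}

/-- The Stieltjes transform `m_μ(z) = ∫ dμ(x) / (x - z)`. -/
def stieltjes (μ : Measure ℝ) (z : ℂ) : ℂ := ∫ x : ℝ, ((x : ℂ) - z)⁻¹ ∂μ

/-- The negative reciprocal Stieltjes transform `F_μ(z) = -1 / m_μ(z)`. -/
def negRecipStieltjes (μ : Measure ℝ) (z : ℂ) : ℂ := -1 / stieltjes μ z

/-- The symmetrization `μ^sym(A) = (μ(A) + μ(-A)) / 2` of a measure on the line. -/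
def symmetrization (μ : Measure ℝ) : Measure ℝ :=
  (2 : ENNReal)⁻¹ • (μ + μ.map (fun x : ℝ => -x))

/-- `ω₁, ω₂ : ℂ⁺ → ℂ⁺` are the subordination functions of the free additive convolution
`μ₁ ⊞ μ₂`. Only the values on `ℂ⁺` matter. -/
structure IsSubordinationPair (μ₁ μ₂ : Measure ℝ) (ω₁ ω₂ : ℂ → ℂ) : Prop where
  analytic₁ : AnalyticOnNhd ℂ ω₁ upperHalf
  analytic₂ : AnalyticOnNhd ℂ ω₂ upperHalf
  mapsTo₁ : Set.MapsTo ω₁ upperHalf upperHalf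
  mapsTo₂ : Set.MapsTo ω₂ upperHalf upperHalf
  im_le₁ : ∀ z ∈ upperHalf, z.im ≤ (ω₁ z).im
  im_le₂ : ∀ z ∈ upperHalf, z.im ≤ (ω₂ z).im
  limit₁ : Tendsto (fun η : ℝ => ω₁ (Complex.I * η) / (Complex.I * η)) atTop (𝓝 1)
  limit₂ : Tendsto (fun η : ℝ => ω₂ (Complex.I * η) / (Complex.I * η)) atTop (𝓝 1)
  subordination : ∀ z ∈ upperHalf,
    negRecipStieltjes μ₁ (ω₂ z) = negRecipStieltjes μ₂ (ω₁ z)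
  sum_eq : ∀ z ∈ upperHalf, ω₁ z + ω₂ z - z = negRecipStieltjes μ₁ (ω₂ z)

/-- The inner radius `r₋ = (∫ x⁻² dμ(x))^(-1/2)`. The integral is taken in `[0, ∞]`, with
`0⁻² = ∞`, and `r₋ = 0` if it diverges. -/
def rMinus (μ : Measure ℝ) : ℝ :=
  Real.sqrt ((∫⁻ x : ℝ, (ENNReal.ofReal (x ^ 2))⁻¹ ∂μ)⁻¹).toReal

/-- The outer radius `r₊ = (∫ x² dμ(x))^(1/2)`. -/
def rPlus (μ : Measure ℝ) : ℝ := Real.sqrt (∫ x : ℝ, x ^ 2 ∂μ)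

/-- `σ₋(r) = ((r² - r₋²) / (r₊² - r₋²))^(1/2)`. -/
def sigmaMinus (μ : Measure ℝ) (r : ℝ) : ℝ :=
  Real.sqrt ((r ^ 2 - rMinus μ ^ 2) / (rPlus μ ^ 2 - rMinus μ ^ 2))

/-- `σ₊(r) = (r₊² / (r₊² - r²))^(1/2)`. -/
def sigmaPlus (μ : Measure ℝ) (r : ℝ) : ℝ :=
  Real.sqrt (rPlus μ ^ 2 / (rPlus μ ^ 2 - r ^ 2))

end

/-! Write `ν` for the symmetrized measure and `h(w) = F_ν(w) - w`. For the symmetrized point mass,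
`F(w) = w - r²/w`, so the subordination equations reduce to `ω₁ = z + h(ω₂)` and `ω₂ = z - r²/ω₁`.
Thus `ω₂(z)` is a fixed point in `ℂ⁺` of `T_z(w) = z - r²/(z + h(w))`. Difference quotients of `h`
are `∫ k_w k_w' dν` for a centered Cauchy kernel `k_w`, and `Im h(w) = Im w ∫ |k_w|² dν`. With
Cauchy–Schwarz these make the fixed point unique (`eq_of_subordinationMap_eq`).

By uniqueness and the symmetry of `ν`, `ω₂(iη) = i(η + v)` with `v > 0` real. Put `g(y) = ∫
dν(x)/(x² + y²)` and `R = r₊²`; the equation becomes `(v² + r²)(η + v) g(η + v) = v`. The trivial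
bound `g(y) ≤ y⁻²` gives `vη ≤ r²`; the chord of the convex function `t ↦ 1/(t + y²)` on `[0, s₊²]`
gives the bound by `σ₊ s₊`. For the lower bound, the equation forces `r² g(η + v) ≤ 1`, which keeps
`η + v` away from zero because `r > r₋`; for large `η` Jensen's inequality `g(y) ≥ 1/(R + y²)` takes
over.

At `z = 0` the equation is `(v² + r²) g(v) = 1`, solvable by the intermediate value theorem. Since
`r² < R`, the derivative of `T_0` at `iv` has modulus below one
(`norm_integral_centeredKernel_sq_lt`). So `T_z` keeps a fixed point near `iv` for small `z`, and by
uniqueness it is `ω₂(z)`. This proves continuity at `0`, and the bounds there follow by letting `η →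
0`. -/

noncomputable section

/-! ### Difference quotients of the Nevanlinna part -/

section Stieltjes

variable {ν : Measure ℝ} {w w' : ℂ}

lemma ofReal_sub_ne_zero_of_im_ne_zero (hw : w.im ≠ 0) (x : ℝ) : (x : ℂ) - w ≠ 0 := by
  intro h
  apply hw
  have := congrArg Complex.im h
  simpa using this

lemma norm_inv_ofReal_sub_le (hw : w.im ≠ 0) (x : ℝ) : ‖((x : ℂ) - w)⁻¹‖ ≤ |w.im|⁻¹ := by
  rw [norm_inv]
  gcongr
  simpa using Complex.abs_im_le_norm ((x : ℂ) - w)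

lemma measurable_inv_ofReal_sub (w : ℂ) : Measurable fun x : ℝ => ((x : ℂ) - w)⁻¹ := by
  fun_prop

lemma integrable_inv_ofReal_sub [IsFiniteMeasure ν] (hw : w.im ≠ 0) :
    Integrable (fun x : ℝ => ((x : ℂ) - w)⁻¹) ν :=
  Integrable.of_bound (measurable_inv_ofReal_sub w).aestronglyMeasurable _
    (Eventually.of_forall (norm_inv_ofReal_sub_le hw))

lemma integrable_inv_ofReal_sub_mul [IsFiniteMeasure ν] (hw : w.im ≠ 0) (hw' : w'.im ≠ 0) :
    Integrable (fun x : ℝ => ((x : ℂ) - w)⁻¹ * ((x : ℂ) - w')⁻¹) ν :=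
  (integrable_inv_ofReal_sub hw').bdd_mul
    (measurable_inv_ofReal_sub w).aestronglyMeasurable
    (Eventually.of_forall (norm_inv_ofReal_sub_le hw))

lemma stieltjes_sub_stieltjes [IsFiniteMeasure ν] (hw : w.im ≠ 0) (hw' : w'.im ≠ 0) :
    stieltjes ν w - stieltjes ν w' =
      (w - w') * ∫ x : ℝ, ((x : ℂ) - w)⁻¹ * ((x : ℂ) - w')⁻¹ ∂ν := by
  rw [stieltjes, stieltjes,
    ← integral_sub (integrable_inv_ofReal_sub hw) (integrable_inv_ofReal_sub hw'),
    ← integral_const_mul]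
  congr 1 with x
  have h1 := ofReal_sub_ne_zero_of_im_ne_zero hw x
  have h2 := ofReal_sub_ne_zero_of_im_ne_zero hw' x
  field_simp
  ring

lemma stieltjes_conj (w : ℂ) :
    stieltjes ν (starRingEnd ℂ w) = starRingEnd ℂ (stieltjes ν w) := by
  rw [stieltjes, stieltjes, ← integral_conj]
  congr 1 with x
  simp

lemma stieltjes_im_pos [IsProbabilityMeasure ν] (hw : 0 < w.im) : 0 < (stieltjes ν w).im := by
  have h : (stieltjes ν w).im = ∫ x : ℝ, (((x : ℂ) - w)⁻¹).im ∂ν :=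
    (integral_im (integrable_inv_ofReal_sub hw.ne')).symm
  rw [h]
  have hpos : ∀ x : ℝ, 0 < (((x : ℂ) - w)⁻¹).im := fun x => by
    rw [Complex.inv_im]
    have := Complex.normSq_pos.2 (ofReal_sub_ne_zero_of_im_ne_zero hw.ne' x)
    simp only [Complex.sub_im, Complex.ofReal_im, zero_sub, neg_neg]
    positivity
  rw [integral_pos_iff_support_of_nonneg (fun x => (hpos x).le)
    (integrable_inv_ofReal_sub hw.ne').im]
  have : (Function.support fun x : ℝ => (((x : ℂ) - w)⁻¹).im) = Set.univ := by
    ext x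
    simpa using (hpos x).ne'
  rw [this]
  simp

lemma stieltjes_ne_zero [IsProbabilityMeasure ν] (hw : w.im ≠ 0) : stieltjes ν w ≠ 0 := by
  rcases lt_or_gt_of_ne hw with h | h
  · intro h0
    have := stieltjes_im_pos (ν := ν) (w := starRingEnd ℂ w) (by simpa using h)
    rw [stieltjes_conj, h0] at this
    simp at this
  · intro h0
    have := stieltjes_im_pos (ν := ν) h
    rw [h0] at this
    simp at this

/-- The Cauchy kernel `1 / (x - w)`, normalized to have integral one, minus one. -/
def centeredKernel (ν : Measure ℝ) (w : ℂ) (x : ℝ) : ℂ :=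
  ((x : ℂ) - w)⁻¹ * (stieltjes ν w)⁻¹ - 1

lemma measurable_centeredKernel (ν : Measure ℝ) (w : ℂ) : Measurable (centeredKernel ν w) := by
  unfold centeredKernel
  fun_prop

lemma exists_norm_centeredKernel_le (hw : w.im ≠ 0) :
    ∃ C, ∀ x, ‖centeredKernel ν w x‖ ≤ C := by
  refine ⟨|w.im|⁻¹ * ‖(stieltjes ν w)⁻¹‖ + 1, fun x => ?_⟩
  refine (norm_sub_le _ _).trans ?_
  rw [norm_mul, norm_one]
  gcongr
  exact norm_inv_ofReal_sub_le hw x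

lemma memLp_centeredKernel [IsFiniteMeasure ν] (hw : w.im ≠ 0) (p : ENNReal) :
    MemLp (centeredKernel ν w) p ν := by
  obtain ⟨C, hC⟩ := exists_norm_centeredKernel_le (ν := ν) hw
  exact MemLp.of_bound (measurable_centeredKernel ν w).aestronglyMeasurable C
    (Eventually.of_forall hC)

lemma integral_centeredKernel_mul [IsProbabilityMeasure ν] (hw : w.im ≠ 0) (hw' : w'.im ≠ 0) :
    ∫ x, centeredKernel ν w x * centeredKernel ν w' x ∂ν =
      (stieltjes ν w)⁻¹ * (stieltjes ν w')⁻¹ *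
        (∫ x : ℝ, ((x : ℂ) - w)⁻¹ * ((x : ℂ) - w')⁻¹ ∂ν) - 1 := by
  have e : ∀ x : ℝ, centeredKernel ν w x * centeredKernel ν w' x =
      (stieltjes ν w)⁻¹ * (stieltjes ν w')⁻¹ * (((x : ℂ) - w)⁻¹ * ((x : ℂ) - w')⁻¹)
        - (stieltjes ν w)⁻¹ * ((x : ℂ) - w)⁻¹ - (stieltjes ν w')⁻¹ * ((x : ℂ) - w')⁻¹ + 1 := by
    intro x
    simp only [centeredKernel]
    ring
  have i1 := (integrable_inv_ofReal_sub_mul (ν := ν) hw hw').const_mul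
    ((stieltjes ν w)⁻¹ * (stieltjes ν w')⁻¹)
  have i2 := (integrable_inv_ofReal_sub (ν := ν) hw).const_mul (stieltjes ν w)⁻¹
  have i3 := (integrable_inv_ofReal_sub (ν := ν) hw').const_mul (stieltjes ν w')⁻¹
  simp_rw [e]
  have i12 : Integrable (fun x : ℝ =>
      (stieltjes ν w)⁻¹ * (stieltjes ν w')⁻¹ * (((x : ℂ) - w)⁻¹ * ((x : ℂ) - w')⁻¹)
        - (stieltjes ν w)⁻¹ * ((x : ℂ) - w)⁻¹) ν := i1.sub i2
  have i123 : Integrable (fun x : ℝ =>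
      (stieltjes ν w)⁻¹ * (stieltjes ν w')⁻¹ * (((x : ℂ) - w)⁻¹ * ((x : ℂ) - w')⁻¹)
        - (stieltjes ν w)⁻¹ * ((x : ℂ) - w)⁻¹ - (stieltjes ν w')⁻¹ * ((x : ℂ) - w')⁻¹) ν :=
    i12.sub i3
  rw [integral_add i123 (integrable_const _), integral_sub i12 i3,
    integral_sub i1 i2, integral_const_mul, integral_const_mul, integral_const_mul]
  have h1 : (stieltjes ν w)⁻¹ * ∫ x : ℝ, ((x : ℂ) - w)⁻¹ ∂ν = 1 :=
    inv_mul_cancel₀ (stieltjes_ne_zero hw)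
  have h2 : (stieltjes ν w')⁻¹ * ∫ x : ℝ, ((x : ℂ) - w')⁻¹ ∂ν = 1 :=
    inv_mul_cancel₀ (stieltjes_ne_zero hw')
  rw [h1, h2]
  simp

/-- The function `w ↦ F_ν(w) - w`. -/
def nevanlinnaPart (ν : Measure ℝ) (w : ℂ) : ℂ := negRecipStieltjes ν w - w

/-- The resolvent identity handles `F_ν`; subtracting `w` is exactly what centering the kernels
accounts for. -/
lemma nevanlinnaPart_sub [IsProbabilityMeasure ν] (hw : w.im ≠ 0) (hw' : w'.im ≠ 0) :
    nevanlinnaPart ν w - nevanlinnaPart ν w' =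
      (w - w') * ∫ x, centeredKernel ν w x * centeredKernel ν w' x ∂ν := by
  rw [integral_centeredKernel_mul hw hw']
  have h := stieltjes_sub_stieltjes (ν := ν) hw hw'
  have h1 := stieltjes_ne_zero (ν := ν) hw
  have h2 := stieltjes_ne_zero (ν := ν) hw'
  simp only [nevanlinnaPart, negRecipStieltjes]
  have : (w - w') * ((stieltjes ν w)⁻¹ * (stieltjes ν w')⁻¹ *
        (∫ x : ℝ, ((x : ℂ) - w)⁻¹ * ((x : ℂ) - w')⁻¹ ∂ν) - 1) =
      (stieltjes ν w)⁻¹ * (stieltjes ν w')⁻¹ * (stieltjes ν w - stieltjes ν w') - (w - w') := by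
    rw [h]; ring
  rw [this]
  field_simp
  ring

lemma nevanlinnaPart_conj (w : ℂ) :
    nevanlinnaPart ν (starRingEnd ℂ w) = starRingEnd ℂ (nevanlinnaPart ν w) := by
  simp [nevanlinnaPart, negRecipStieltjes, stieltjes_conj]

lemma centeredKernel_conj (w : ℂ) (x : ℝ) :
    centeredKernel ν (starRingEnd ℂ w) x = starRingEnd ℂ (centeredKernel ν w x) := by
  simp [centeredKernel, stieltjes_conj]

/-- The difference formula at `w` and its conjugate, where the product of kernels becomes a squared
modulus. -/
lemma nevanlinnaPart_im [IsProbabilityMeasure ν] (hw : w.im ≠ 0) :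
    (nevanlinnaPart ν w).im = w.im * ∫ x, ‖centeredKernel ν w x‖ ^ 2 ∂ν := by
  have h := nevanlinnaPart_sub (ν := ν) hw (w' := starRingEnd ℂ w) (by simpa using hw)
  simp_rw [nevanlinnaPart_conj, centeredKernel_conj, Complex.mul_conj, Complex.sub_conj,
    Complex.normSq_eq_norm_sq] at h
  rw [integral_complex_ofReal] at h
  have := congrArg Complex.im h
  simp at this
  linarith

lemma nevanlinnaPart_im_nonneg [IsProbabilityMeasure ν] (hw : 0 < w.im) :
    0 ≤ (nevanlinnaPart ν w).im := by
  rw [nevanlinnaPart_im hw.ne']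
  exact mul_nonneg hw.le (integral_nonneg fun _ => by positivity)

lemma norm_integral_mul_sq_le {f g : ℝ → ℂ} (hf : MemLp f 2 ν) (hg : MemLp g 2 ν) :
    ‖∫ x, f x * g x ∂ν‖ ^ 2 ≤ (∫ x, ‖f x‖ ^ 2 ∂ν) * ∫ x, ‖g x‖ ^ 2 ∂ν := by
  have h1 : ‖∫ x, f x * g x ∂ν‖ ≤ ∫ x, ‖f x‖ * ‖g x‖ ∂ν := by
    refine (norm_integral_le_integral_norm _).trans_eq ?_
    simp
  have h2 := integral_mul_norm_le_Lp_mul_Lq (μ := ν) (p := 2) (q := 2) (f := f) (g := g)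
    (by constructor <;> norm_num) (by simpa using hf) (by simpa using hg)
  have hf0 : 0 ≤ ∫ x, ‖f x‖ ^ 2 ∂ν := integral_nonneg fun _ => by positivity
  have hg0 : 0 ≤ ∫ x, ‖g x‖ ^ 2 ∂ν := integral_nonneg fun _ => by positivity
  simp only [Real.rpow_two, ← Real.sqrt_eq_rpow] at h2
  calc _ ≤ (√(∫ x, ‖f x‖ ^ 2 ∂ν) * √(∫ x, ‖g x‖ ^ 2 ∂ν)) ^ 2 := by
        gcongr
        exact h1.trans h2
    _ = _ := by rw [mul_pow, Real.sq_sqrt hf0, Real.sq_sqrt hg0]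

/-- Cauchy–Schwarz, with both `L²` norms expressed through imaginary parts of `h`. This is the
Schwarz–Pick type estimate behind uniqueness. -/
lemma im_mul_norm_integral_centeredKernel_sq_le [IsProbabilityMeasure ν]
    (hw : 0 < w.im) (hw' : 0 < w'.im) :
    w.im * w'.im * ‖∫ x, centeredKernel ν w x * centeredKernel ν w' x ∂ν‖ ^ 2 ≤
      (nevanlinnaPart ν w).im * (nevanlinnaPart ν w').im := by
  rw [nevanlinnaPart_im hw.ne', nevanlinnaPart_im hw'.ne']
  have := norm_integral_mul_sq_le (memLp_centeredKernel (ν := ν) hw.ne' 2)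
    (memLp_centeredKernel (ν := ν) hw'.ne' 2)
  refine (mul_le_mul_of_nonneg_left this (mul_pos hw hw').le).trans_eq ?_
  ring

end Stieltjes

/-! ### The fixed point equation and uniqueness -/

section Subordination

variable {ν : Measure ℝ} {r : ℝ} {z w w' : ℂ}

/-- The map whose fixed point in the upper half-plane is the value of `ω₂` at `z`, for the free
additive convolution of `ν` with the symmetrization of `δ_r`. -/
def subordinationMap (ν : Measure ℝ) (r : ℝ) (z w : ℂ) : ℂ :=
  z - (r : ℂ) ^ 2 / (z + nevanlinnaPart ν w)

lemma stieltjes_symmetrization_dirac (r : ℝ) (w : ℂ) :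
    stieltjes (symmetrization (Measure.dirac r)) w =
      2⁻¹ * (((r : ℂ) - w)⁻¹ + (-(r : ℂ) - w)⁻¹) := by
  have hm : Measure.map (fun x : ℝ => -x) (Measure.dirac r) = Measure.dirac (-r) :=
    Measure.map_dirac' measurable_neg r
  have hi : ∀ a : ℝ, Integrable (fun x : ℝ => ((x : ℂ) - w)⁻¹) (Measure.dirac a) := fun a =>
    integrable_dirac (by simp)
  rw [stieltjes, symmetrization, hm, integral_smul_measure,
    integral_add_measure (hi r) (hi (-r)), integral_dirac, integral_dirac]
  simp [Complex.real_smul, mul_add]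

lemma negRecipStieltjes_symmetrization_dirac (hw : w.im ≠ 0) :
    negRecipStieltjes (symmetrization (Measure.dirac r)) w = w - (r : ℂ) ^ 2 / w := by
  have h1 := ofReal_sub_ne_zero_of_im_ne_zero hw r
  have h2 : -(r : ℂ) - w ≠ 0 := by
    simpa using ofReal_sub_ne_zero_of_im_ne_zero hw (-r)
  have h0 : w ≠ 0 := by rintro rfl; simp at hw
  rw [negRecipStieltjes, stieltjes_symmetrization_dirac]
  have : 2⁻¹ * (((r : ℂ) - w)⁻¹ + (-(r : ℂ) - w)⁻¹) = -w / (((r : ℂ) - w) * (-(r : ℂ) - w)) := by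
    field_simp
    ring
  rw [this]
  field_simp
  ring

lemma IsSubordinationPair.sub_eq {ω₁ ω₂ : ℂ → ℂ}
    (h : IsSubordinationPair ν (symmetrization (Measure.dirac r)) ω₁ ω₂) (hz : z ∈ upperHalf) :
    ω₂ z - z = -((r : ℂ) ^ 2 / ω₁ z) := by
  have h1 := h.sum_eq z hz
  rw [h.subordination z hz, negRecipStieltjes_symmetrization_dirac
    (ne_of_gt (h.mapsTo₁ hz))] at h1
  linear_combination h1

lemma IsSubordinationPair.subordinationMap_eq {ω₁ ω₂ : ℂ → ℂ}
    (h : IsSubordinationPair ν (symmetrization (Measure.dirac r)) ω₁ ω₂) (hz : z ∈ upperHalf) :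
    subordinationMap ν r z (ω₂ z) = ω₂ z := by
  have h1 := h.sum_eq z hz
  have h2 := h.sub_eq hz
  have : z + nevanlinnaPart ν (ω₂ z) = ω₁ z := by
    rw [nevanlinnaPart]; linear_combination -h1
  rw [subordinationMap, this]
  linear_combination -h2

lemma subordinationMap_sub [IsProbabilityMeasure ν] (hw : w.im ≠ 0) (hw' : w'.im ≠ 0)
    (ha : z + nevanlinnaPart ν w ≠ 0) (ha' : z + nevanlinnaPart ν w' ≠ 0) :
    subordinationMap ν r z w - subordinationMap ν r z w' =
      (r : ℂ) ^ 2 * (∫ x, centeredKernel ν w x * centeredKernel ν w' x ∂ν) /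
        ((z + nevanlinnaPart ν w) * (z + nevanlinnaPart ν w')) * (w - w') := by
  have h := nevanlinnaPart_sub (ν := ν) hw hw'
  have e : (r : ℂ) ^ 2 * (∫ x, centeredKernel ν w x * centeredKernel ν w' x ∂ν) /
        ((z + nevanlinnaPart ν w) * (z + nevanlinnaPart ν w')) * (w - w') =
      (r : ℂ) ^ 2 * ((w - w') * ∫ x, centeredKernel ν w x * centeredKernel ν w' x ∂ν) /
        ((z + nevanlinnaPart ν w) * (z + nevanlinnaPart ν w')) := by ring
  rw [e, ← h, subordinationMap, subordinationMap]
  field_simp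
  ring

lemma im_eq_of_subordinationMap_eq (h : subordinationMap ν r z w = w) :
    w.im = z.im + r ^ 2 * (z + nevanlinnaPart ν w).im / ‖z + nevanlinnaPart ν w‖ ^ 2 := by
  have h1 := congrArg Complex.im h
  rw [subordinationMap, Complex.sub_im, ← Complex.ofReal_pow, div_eq_mul_inv,
    Complex.im_ofReal_mul, Complex.inv_im, Complex.normSq_eq_norm_sq] at h1
  rw [← h1]
  ring

/-- The fixed point of the subordination map in the upper half-plane is unique. -/
lemma eq_of_subordinationMap_eq [IsProbabilityMeasure ν] (hr : 0 < r) (hz : 0 < z.im)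
    (hw : 0 < w.im) (hw' : 0 < w'.im) (h : subordinationMap ν r z w = w)
    (h' : subordinationMap ν r z w' = w') : w = w' := by
  by_contra hne
  have hn := nevanlinnaPart_im_nonneg (ν := ν) hw
  have hn' := nevanlinnaPart_im_nonneg (ν := ν) hw'
  have ha : 0 < (z + nevanlinnaPart ν w).im := by rw [Complex.add_im]; positivity
  have ha' : 0 < (z + nevanlinnaPart ν w').im := by rw [Complex.add_im]; positivity
  have ha0 : z + nevanlinnaPart ν w ≠ 0 := fun h0 => by simp [h0] at ha
  have ha0' : z + nevanlinnaPart ν w' ≠ 0 := fun h0 => by simp [h0] at ha'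
  have hd := subordinationMap_sub (r := r) hw.ne' hw'.ne' ha0 ha0'
  have hK := im_mul_norm_integral_centeredKernel_sq_le (ν := ν) hw hw'
  have e := im_eq_of_subordinationMap_eq h
  have e' := im_eq_of_subordinationMap_eq h'
  rw [h, h'] at hd
  -- Two distinct fixed points force the difference quotient of `T_z` to equal one.
  have hnorm : r ^ 2 * ‖∫ x, centeredKernel ν w x * centeredKernel ν w' x ∂ν‖ =
      ‖z + nevanlinnaPart ν w‖ * ‖z + nevanlinnaPart ν w'‖ := by
    have h1 := mul_right_cancel₀ (sub_ne_zero.2 hne) ((one_mul _).trans hd)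
    have h2 := congrArg norm ((eq_div_iff (mul_ne_zero ha0 ha0')).1 h1)
    simpa using h2.symm
  have f : (nevanlinnaPart ν w).im < (z + nevanlinnaPart ν w).im := by
    rw [Complex.add_im]; linarith
  have f' : (nevanlinnaPart ν w').im < (z + nevanlinnaPart ν w').im := by
    rw [Complex.add_im]; linarith
  generalize (∫ x, centeredKernel ν w x * centeredKernel ν w' x ∂ν) = K at *
  generalize (nevanlinnaPart ν w).im = p at *
  generalize (nevanlinnaPart ν w').im = p' at *
  have hA : 0 < ‖z + nevanlinnaPart ν w‖ := norm_pos_iff.2 ha0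
  have hA' : 0 < ‖z + nevanlinnaPart ν w'‖ := norm_pos_iff.2 ha0'
  generalize ‖z + nevanlinnaPart ν w‖ = A at *
  generalize ‖z + nevanlinnaPart ν w'‖ = A' at *
  generalize (z + nevanlinnaPart ν w).im = q at *
  generalize (z + nevanlinnaPart ν w').im = q' at *
  -- With `p = Im h` and `q = Im (z + h)`, inserting these bounds into the Cauchy–Schwarz estimate
  -- yields `q q' ≤ p p'`, against `p < q` and `p' < q'`, which hold since `Im z > 0`.
  have g : r ^ 2 * q / A ^ 2 ≤ w.im := by linarith
  have g' : r ^ 2 * q' / A' ^ 2 ≤ w'.im := by linarith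
  have k : ‖K‖ = A * A' / r ^ 2 := by field_simp; linarith
  have : (r ^ 2 * q / A ^ 2) * (r ^ 2 * q' / A' ^ 2) * ‖K‖ ^ 2 ≤ p * p' := by
    refine le_trans ?_ hK
    gcongr
  have k2 : (r ^ 2 * q / A ^ 2) * (r ^ 2 * q' / A' ^ 2) * ‖K‖ ^ 2 = q * q' := by
    rw [k]; field_simp
  have k3 : p * p' < q * q' := by
    calc p * p' ≤ p * q' := by gcongr
      _ < q * q' := by gcongr
  linarith

lemma stieltjes_neg (hν : ν.map (fun x : ℝ => -x) = ν) (w : ℂ) :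
    stieltjes ν (-w) = -stieltjes ν w := by
  have hm : Measurable fun x : ℝ => -x := measurable_neg
  have hsm : AEStronglyMeasurable (fun x : ℝ => ((x : ℂ) - w)⁻¹)
      (ν.map (fun x : ℝ => -x)) := (measurable_inv_ofReal_sub w).aestronglyMeasurable
  have : stieltjes ν w = ∫ x : ℝ, ((x : ℂ) - w)⁻¹ ∂(ν.map (fun x : ℝ => -x)) := by
    rw [hν, stieltjes]
  rw [this, integral_map hm.aemeasurable hsm, stieltjes, ← integral_neg]
  congr 1 with x
  rw [← inv_neg]
  push_cast
  ring_nf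

lemma nevanlinnaPart_neg (hν : ν.map (fun x : ℝ => -x) = ν) (w : ℂ) :
    nevanlinnaPart ν (-w) = -nevanlinnaPart ν w := by
  simp only [nevanlinnaPart, negRecipStieltjes, stieltjes_neg hν]
  ring

/-- Equivariance under reflection in the imaginary axis; together with uniqueness it makes fixed
points purely imaginary when `z` is. -/
lemma subordinationMap_neg_conj (hν : ν.map (fun x : ℝ => -x) = ν) (z w : ℂ) :
    subordinationMap ν r (-starRingEnd ℂ z) (-starRingEnd ℂ w) =
      -starRingEnd ℂ (subordinationMap ν r z w) := by
  simp only [subordinationMap, nevanlinnaPart_neg hν, nevanlinnaPart_conj, map_sub, map_div₀,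
    map_add, map_pow, Complex.conj_ofReal]
  rw [← neg_add, div_neg]
  ring

lemma re_eq_zero_of_subordinationMap_eq [IsProbabilityMeasure ν]
    (hν : ν.map (fun x : ℝ => -x) = ν) (hr : 0 < r) (hz : 0 < z.im) (hz0 : z.re = 0)
    (hw : 0 < w.im) (h : subordinationMap ν r z w = w) : w.re = 0 := by
  have hz' : -starRingEnd ℂ z = z := by
    apply Complex.ext <;> simp [hz0]
  have h2 := subordinationMap_neg_conj (r := r) hν z w
  rw [hz', h] at h2
  have := eq_of_subordinationMap_eq hr hz (by simpa using hw) hw h2 h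
  have := congrArg Complex.re this
  simp at this
  linarith

end Subordination

/-! ### Reduction to a real equation on the imaginary axis -/

section ImaginaryAxis

variable {ν : Measure ℝ} {r s y η : ℝ}

/-- The integral `∫ dν(x) / (x² + y²)`. -/
def cauchyMean (ν : Measure ℝ) (y : ℝ) : ℝ := ∫ x : ℝ, (x ^ 2 + y ^ 2)⁻¹ ∂ν

lemma measurable_inv_sq_add_sq (y : ℝ) : Measurable fun x : ℝ => (x ^ 2 + y ^ 2)⁻¹ := by
  fun_prop

lemma norm_inv_sq_add_sq_le (hy : 0 < y) (x : ℝ) : ‖(x ^ 2 + y ^ 2)⁻¹‖ ≤ (y ^ 2)⁻¹ := by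
  rw [Real.norm_of_nonneg (by positivity)]
  gcongr
  nlinarith [sq_nonneg x]

lemma integrable_inv_sq_add_sq [IsFiniteMeasure ν] (hy : 0 < y) :
    Integrable (fun x : ℝ => (x ^ 2 + y ^ 2)⁻¹) ν :=
  Integrable.of_bound (measurable_inv_sq_add_sq y).aestronglyMeasurable _
    (Eventually.of_forall (norm_inv_sq_add_sq_le hy))

lemma cauchyMean_anti [IsFiniteMeasure ν] {y' : ℝ} (hy : 0 < y) (h : y ≤ y') :
    cauchyMean ν y' ≤ cauchyMean ν y := by
  refine integral_mono (integrable_inv_sq_add_sq (hy.trans_le h)) (integrable_inv_sq_add_sq hy)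
    fun x => ?_
  have : 0 < x ^ 2 + y ^ 2 := by positivity
  dsimp only
  gcongr

lemma cauchyMean_le [IsProbabilityMeasure ν] (hy : 0 < y) : cauchyMean ν y ≤ (y ^ 2)⁻¹ := by
  have h := integral_mono (μ := ν) (integrable_inv_sq_add_sq hy) (integrable_const (y ^ 2)⁻¹)
    fun x => (Real.le_norm_self _).trans (norm_inv_sq_add_sq_le hy x)
  simpa [cauchyMean] using h

/-- Jensen's inequality for `t ↦ 1 / (t + y²)`. -/
lemma le_cauchyMean [IsProbabilityMeasure ν] (hy : 0 < y)
    (hi : Integrable (fun x : ℝ => x ^ 2) ν) :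
    (∫ x, x ^ 2 ∂ν + y ^ 2)⁻¹ ≤ cauchyMean ν y := by
  set R := ∫ x, x ^ 2 ∂ν with hR
  have hR0 : 0 ≤ R := integral_nonneg fun x => by positivity
  have hRy : 0 < R + y ^ 2 := by positivity
  have i2 : Integrable (fun x : ℝ => (x ^ 2 - R) * ((R + y ^ 2) ^ 2)⁻¹) ν :=
    (hi.sub (integrable_const R)).mul_const _
  have h : ∫ x : ℝ, ((R + y ^ 2)⁻¹ - (x ^ 2 - R) * ((R + y ^ 2) ^ 2)⁻¹) ∂ν ≤ cauchyMean ν y := by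
    refine integral_mono ((integrable_const _).sub i2) (integrable_inv_sq_add_sq hy) fun x => ?_
    have hx : 0 < x ^ 2 + y ^ 2 := by positivity
    -- The graph minus its tangent at `t = R`, displayed as a nonnegative quantity.
    have : (x ^ 2 + y ^ 2)⁻¹ - ((R + y ^ 2)⁻¹ - (x ^ 2 - R) * ((R + y ^ 2) ^ 2)⁻¹) =
        (x ^ 2 - R) ^ 2 * ((x ^ 2 + y ^ 2)⁻¹ * ((R + y ^ 2) ^ 2)⁻¹) := by
      field_simp
      ring
    have h0 : 0 ≤ (x ^ 2 - R) ^ 2 * ((x ^ 2 + y ^ 2)⁻¹ * ((R + y ^ 2) ^ 2)⁻¹) := by positivity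
    dsimp only
    linarith
  rw [integral_sub (integrable_const _) i2, integral_mul_const,
    integral_sub hi (integrable_const R), ← hR] at h
  simpa using h

lemma cauchyMean_pos [IsProbabilityMeasure ν] (hy : 0 < y)
    (hi : Integrable (fun x : ℝ => x ^ 2) ν) : 0 < cauchyMean ν y := by
  refine lt_of_lt_of_le ?_ (le_cauchyMean hy hi)
  have : 0 ≤ ∫ x, x ^ 2 ∂ν := integral_nonneg fun x => by positivity
  positivity

/-- The chord of `t ↦ 1 / (t + y²)` on `[0, s²]` lies above its graph. -/
lemma cauchyMean_le_chord [IsProbabilityMeasure ν] (hy : 0 < y)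
    (hi : Integrable (fun x : ℝ => x ^ 2) ν) (hs : ∀ᵐ x ∂ν, x ^ 2 ≤ s ^ 2) :
    cauchyMean ν y ≤ (s ^ 2 + y ^ 2 - ∫ x, x ^ 2 ∂ν) / (y ^ 2 * (s ^ 2 + y ^ 2)) := by
  have i2 : Integrable (fun x : ℝ => (s ^ 2 + y ^ 2 - x ^ 2) / (y ^ 2 * (s ^ 2 + y ^ 2))) ν :=
    ((integrable_const _).sub hi).div_const _
  have h : cauchyMean ν y ≤ ∫ x : ℝ, (s ^ 2 + y ^ 2 - x ^ 2) / (y ^ 2 * (s ^ 2 + y ^ 2)) ∂ν := by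
    refine integral_mono_ae (integrable_inv_sq_add_sq hy) i2 ?_
    filter_upwards [hs] with x hx
    have hxy : 0 < x ^ 2 + y ^ 2 := by positivity
    have : (s ^ 2 + y ^ 2 - x ^ 2) / (y ^ 2 * (s ^ 2 + y ^ 2)) - (x ^ 2 + y ^ 2)⁻¹ =
        x ^ 2 * (s ^ 2 - x ^ 2) / ((y ^ 2 * (s ^ 2 + y ^ 2)) * (x ^ 2 + y ^ 2)) := by
      field_simp
      ring
    have h0 : 0 ≤ x ^ 2 * (s ^ 2 - x ^ 2) / ((y ^ 2 * (s ^ 2 + y ^ 2)) * (x ^ 2 + y ^ 2)) :=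
      div_nonneg (mul_nonneg (sq_nonneg x) (sub_nonneg.2 hx)) (by positivity)
    linarith
  rw [integral_div, integral_sub (integrable_const _) hi] at h
  simpa using h

lemma continuousAt_cauchyMean [IsFiniteMeasure ν] (hy : 0 < y) :
    ContinuousAt (cauchyMean ν) y := by
  refine continuousAt_of_dominated (bound := fun _ => ((y / 2) ^ 2)⁻¹)
    (Eventually.of_forall fun t => (measurable_inv_sq_add_sq t).aestronglyMeasurable) ?_
    (integrable_const _) (Eventually.of_forall fun x => ?_)
  · filter_upwards [lt_mem_nhds (half_lt_self hy)] with t ht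
    refine Eventually.of_forall fun x => ?_
    refine (norm_inv_sq_add_sq_le ((half_pos hy).trans ht) x).trans ?_
    gcongr
  · have : x ^ 2 + y ^ 2 ≠ 0 := by positivity
    fun_prop (disch := assumption)

lemma integral_odd_eq_zero {E : Type*} [NormedAddCommGroup E] [NormedSpace ℝ E]
    (hν : ν.map (fun x : ℝ => -x) = ν) {f : ℝ → E} (hf : ∀ x, f (-x) = -f x) :
    ∫ x, f x ∂ν = 0 := by
  have h : ∫ x, f x ∂ν = ∫ x, f (-x) ∂ν := by
    conv_lhs => rw [← hν]
    exact integral_map_equiv (MeasurableEquiv.neg ℝ) f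
  simp_rw [hf, integral_neg] at h
  have h2 : (2 : ℝ) • ∫ x, f x ∂ν = 0 := by
    rw [two_smul]
    nth_rewrite 1 [h]
    simp
  exact (smul_eq_zero.1 h2).resolve_left two_ne_zero

lemma inv_ofReal_sub_I_mul (hy : 0 < y) (x : ℝ) :
    ((x : ℂ) - Complex.I * y)⁻¹ =
      ((x * (x ^ 2 + y ^ 2)⁻¹ : ℝ) : ℂ) + Complex.I * y * (((x ^ 2 + y ^ 2)⁻¹ : ℝ) : ℂ) := by
  have hxy : ((x : ℂ) ^ 2 + (y : ℂ) ^ 2) ≠ 0 := by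
    have : x ^ 2 + y ^ 2 ≠ 0 := by positivity
    exact_mod_cast this
  have h := ofReal_sub_ne_zero_of_im_ne_zero (w := Complex.I * y) (by simpa using hy.ne') x
  rw [inv_eq_iff_eq_inv, ← inv_eq_iff_eq_inv]
  refine inv_eq_of_mul_eq_one_right ?_
  push_cast
  field_simp
  linear_combination (-(y : ℂ) ^ 2) * Complex.I_sq

lemma stieltjes_I_mul [IsFiniteMeasure ν] (hν : ν.map (fun x : ℝ => -x) = ν) (hy : 0 < y) :
    stieltjes ν (Complex.I * y) = Complex.I * ((y * cauchyMean ν y : ℝ) : ℂ) := by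
  have hbase : Integrable (fun x : ℝ => ((x : ℂ) - Complex.I * y)⁻¹) ν :=
    integrable_inv_ofReal_sub (by simpa using hy.ne')
  have i2 : Integrable (fun x : ℝ => Complex.I * y * (((x ^ 2 + y ^ 2)⁻¹ : ℝ) : ℂ)) ν :=
    (integrable_inv_sq_add_sq hy).ofReal.const_mul _
  have i1 : Integrable (fun x : ℝ => ((x * (x ^ 2 + y ^ 2)⁻¹ : ℝ) : ℂ)) ν := by
    refine (hbase.sub i2).congr (Eventually.of_forall fun x => ?_)
    simp only [Pi.sub_apply]
    rw [inv_ofReal_sub_I_mul hy]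
    ring
  rw [stieltjes]
  simp_rw [inv_ofReal_sub_I_mul hy]
  rw [integral_add i1 i2, integral_odd_eq_zero hν fun x => by push_cast; ring_nf,
    integral_const_mul, integral_complex_ofReal, cauchyMean]
  push_cast
  ring

lemma nevanlinnaPart_I_mul [IsFiniteMeasure ν] (hν : ν.map (fun x : ℝ => -x) = ν) (hy : 0 < y) :
    nevanlinnaPart ν (Complex.I * y) = Complex.I * (((y * cauchyMean ν y)⁻¹ - y : ℝ) : ℂ) := by
  rw [nevanlinnaPart, negRecipStieltjes, stieltjes_I_mul hν hy]
  push_cast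
  rw [neg_div, one_div, mul_inv, Complex.inv_I]
  ring

/-- On the imaginary axis the fixed point equation is an equation between real numbers. -/
lemma subordinationMap_I_mul_eq_iff [IsProbabilityMeasure ν] (hν : ν.map (fun x : ℝ => -x) = ν)
    (hi : Integrable (fun x : ℝ => x ^ 2) ν) (hy : 0 < y)
    (hpos : 0 < η + ((y * cauchyMean ν y)⁻¹ - y)) :
    subordinationMap ν r (Complex.I * η) (Complex.I * y) = Complex.I * y ↔
      ((y - η) ^ 2 + r ^ 2) * (y * cauchyMean ν y) = y - η := by
  have hG := cauchyMean_pos (ν := ν) hy hi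
  set g := y * cauchyMean ν y with hg
  have hg0 : 0 < g := by positivity
  rw [subordinationMap, nevanlinnaPart_I_mul hν hy, ← mul_add, ← hg]
  have e : Complex.I * (η : ℂ) - (r : ℂ) ^ 2 / (Complex.I * ((η : ℂ) + ((g⁻¹ - y : ℝ) : ℂ))) =
      Complex.I * ((η + r ^ 2 / (η + (g⁻¹ - y)) : ℝ) : ℂ) := by
    push_cast
    rw [div_mul_eq_div_div, Complex.div_I]
    ring
  rw [e]
  have hI : ∀ a b : ℝ, Complex.I * (a : ℂ) = Complex.I * b ↔ a = b := fun a b => by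
    simp [Complex.I_ne_zero]
  rw [hI]
  constructor
  · intro h
    have h1 : r ^ 2 / (η + (g⁻¹ - y)) = y - η := by linarith
    rw [div_eq_iff hpos.ne'] at h1
    have : (y - η) * (g⁻¹ * g) = ((y - η) ^ 2 + r ^ 2) * g := by rw [h1]; ring
    rw [inv_mul_cancel₀ hg0.ne', mul_one] at this
    exact this.symm
  · intro h
    have h1 : r ^ 2 = (y - η) * (η + (g⁻¹ - y)) := by
      have : (y - η) ^ 2 + r ^ 2 = (y - η) * g⁻¹ := (eq_mul_inv_iff_mul_eq₀ hg0.ne').2 h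
      linear_combination this
    rw [h1, mul_div_assoc, div_self hpos.ne']
    ring

end ImaginaryAxis

/-! ### Upper and lower bounds for the real solution -/

section Bounds

variable {ν : Measure ℝ} {r s v y η : ℝ}

lemma IsSubordinationPair.exists_real_solution [IsProbabilityMeasure ν] {ω₁ ω₂ : ℂ → ℂ}
    (hν : ν.map (fun x : ℝ => -x) = ν) (hi : Integrable (fun x : ℝ => x ^ 2) ν) (hr : 0 < r)
    (h : IsSubordinationPair ν (symmetrization (Measure.dirac r)) ω₁ ω₂) (hη : 0 < η) :
    ∃ v : ℝ, 0 < v ∧ ω₂ (Complex.I * η) = Complex.I * η + Complex.I * v ∧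
      (v ^ 2 + r ^ 2) * ((η + v) * cauchyMean ν (η + v)) = v := by
  have hz : Complex.I * (η : ℂ) ∈ upperHalf := by simpa [upperHalf] using hη
  have hfix := h.subordinationMap_eq hz
  have hw : 0 < (ω₂ (Complex.I * η)).im := h.mapsTo₂ hz
  have hre := re_eq_zero_of_subordinationMap_eq hν hr hz (by simp) hw hfix
  have him := im_eq_of_subordinationMap_eq hfix
  obtain ⟨y, hy⟩ : ∃ y : ℝ, ω₂ (Complex.I * η) = Complex.I * y :=
    ⟨(ω₂ (Complex.I * η)).im, by apply Complex.ext <;> simp [hre]⟩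
  rw [hy] at hw hfix him
  simp only [Complex.mul_im, Complex.I_re, Complex.I_im, Complex.ofReal_im, Complex.ofReal_re,
    zero_mul, one_mul, zero_add] at hw him
  have hn := nevanlinnaPart_im_nonneg (ν := ν) (w := Complex.I * y) (by simpa using hw)
  have ha : 0 < (Complex.I * η + nevanlinnaPart ν (Complex.I * y)).im := by
    have : (0 : ℝ) < (Complex.I * (η : ℂ)).im := hz
    rw [Complex.add_im]
    positivity
  have ha0 : 0 < ‖Complex.I * η + nevanlinnaPart ν (Complex.I * y)‖ :=
    norm_pos_iff.2 fun h0 => by simp [h0] at ha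
  have hv : 0 < y - η := by
    have : 0 < r ^ 2 * (Complex.I * η + nevanlinnaPart ν (Complex.I * y)).im /
      ‖Complex.I * η + nevanlinnaPart ν (Complex.I * y)‖ ^ 2 := by positivity
    linarith
  have hpos : 0 < η + ((y * cauchyMean ν y)⁻¹ - y) := by
    rw [nevanlinnaPart_I_mul hν hw] at ha
    simpa using ha
  refine ⟨y - η, hv, ?_, ?_⟩
  · rw [hy]; push_cast; ring
  · rw [add_sub_cancel]
    exact (subordinationMap_I_mul_eq_iff hν hi hw hpos).1 hfix

lemma mul_le_sq_of_real_solution [IsProbabilityMeasure ν] (hη : 0 < η) (hv : 0 < v)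
    (h : (v ^ 2 + r ^ 2) * ((η + v) * cauchyMean ν (η + v)) = v) : v * η ≤ r ^ 2 := by
  have hy : 0 < η + v := by positivity
  have h1 : (v ^ 2 + r ^ 2) * ((η + v) * cauchyMean ν (η + v)) ≤
      (v ^ 2 + r ^ 2) * ((η + v) * ((η + v) ^ 2)⁻¹) := by
    gcongr
    exact cauchyMean_le hy
  rw [h, sq (η + v), mul_inv, mul_inv_cancel_left₀ hy.ne', ← div_eq_mul_inv, le_div_iff₀ hy] at h1
  nlinarith

/-- Inserting the chord bound cancels the terms `v² (s² + (η + v)²)`; the mixed term `2 r² v η` that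
remains is absorbed by `vη ≤ r²`. -/
lemma sq_mul_le_of_real_solution [IsProbabilityMeasure ν] (hi : Integrable (fun x : ℝ => x ^ 2) ν)
    (hs : ∀ᵐ x ∂ν, x ^ 2 ≤ s ^ 2) (hη : 0 < η) (hv : 0 < v)
    (h : (v ^ 2 + r ^ 2) * ((η + v) * cauchyMean ν (η + v)) = v) :
    v ^ 2 * (∫ x, x ^ 2 ∂ν - r ^ 2) ≤ r ^ 2 * (s ^ 2 + 2 * r ^ 2 + η ^ 2) := by
  have hy : 0 < η + v := by positivity
  set R := ∫ x, x ^ 2 ∂ν with hR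
  have hR0 : 0 ≤ R := integral_nonneg fun x => by positivity
  have h1 : (v ^ 2 + r ^ 2) * ((η + v) * cauchyMean ν (η + v)) ≤ (v ^ 2 + r ^ 2) * ((η + v) *
      ((s ^ 2 + (η + v) ^ 2 - R) / ((η + v) ^ 2 * (s ^ 2 + (η + v) ^ 2)))) := by
    gcongr
    exact cauchyMean_le_chord hy hi hs
  have e : (v ^ 2 + r ^ 2) * ((η + v) *
      ((s ^ 2 + (η + v) ^ 2 - R) / ((η + v) ^ 2 * (s ^ 2 + (η + v) ^ 2)))) =
      (v ^ 2 + r ^ 2) * (s ^ 2 + (η + v) ^ 2 - R) / ((η + v) * (s ^ 2 + (η + v) ^ 2)) := by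
    field_simp
  rw [h, e, le_div_iff₀ (by positivity)] at h1
  have h2 := mul_le_sq_of_real_solution hη hv h
  have h3 : 0 ≤ v * η * (s ^ 2 + (η + v) ^ 2) := by positivity
  have h4 : 0 ≤ r ^ 2 * R := by positivity
  have h5 : r ^ 2 * (v * η) ≤ r ^ 2 * r ^ 2 := by gcongr
  nlinarith

/-- For `η ≤ s` the quadratic bound suffices: `r² ≤ R ≤ s²` gives `s² + 2r² + η² ≤ 4s²`, whence the
factor `2`. For `η ≥ s` the bound `vη ≤ r² ≤ s²` already gives `v ≤ s`. -/
lemma le_two_mul_of_real_solution [IsProbabilityMeasure ν]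
    (hi : Integrable (fun x : ℝ => x ^ 2) ν) (hs : ∀ᵐ x ∂ν, x ^ 2 ≤ s ^ 2) (hs0 : 0 < s)
    (hrR : r ^ 2 < ∫ x, x ^ 2 ∂ν) (hη : 0 < η) (hv : 0 < v)
    (h : (v ^ 2 + r ^ 2) * ((η + v) * cauchyMean ν (η + v)) = v) :
    v ≤ 2 * (√((∫ x, x ^ 2 ∂ν) / (∫ x, x ^ 2 ∂ν - r ^ 2)) * s) := by
  have h1 := sq_mul_le_of_real_solution hi hs hη hv h
  have h2 := mul_le_sq_of_real_solution hη hv h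
  have hRs : ∫ x, x ^ 2 ∂ν ≤ s ^ 2 := by
    simpa using integral_mono_ae hi (integrable_const (μ := ν) (s ^ 2)) hs
  set R := ∫ x, x ^ 2 ∂ν with hR
  have hd : 0 < R - r ^ 2 := sub_pos.2 hrR
  have hR0 : 0 ≤ R := (sq_nonneg r).trans hrR.le
  rcases le_total η s with hηs | hηs
  · refine le_of_sq_le_sq ?_ (by positivity)
    rw [mul_pow, mul_pow, Real.sq_sqrt (by positivity), div_mul_eq_mul_div, mul_div_assoc',
      le_div_iff₀ hd]
    have : η ^ 2 ≤ s ^ 2 := by gcongr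
    have h6 : r ^ 2 * (s ^ 2 + 2 * r ^ 2 + η ^ 2) ≤ R * (s ^ 2 + 2 * s ^ 2 + s ^ 2) := by
      have : r ^ 2 ≤ s ^ 2 := hrR.le.trans hRs
      exact mul_le_mul hrR.le (by linarith) (by positivity) hR0
    have h7 : R * (s ^ 2 + 2 * s ^ 2 + s ^ 2) = 2 ^ 2 * (R * s ^ 2) := by ring
    linarith
  · have hσ : 1 ≤ √(R / (R - r ^ 2)) := by
      rw [Real.one_le_sqrt, one_le_div hd]
      nlinarith [sq_nonneg r]
    have h3 : v * s ≤ s * s := by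
      calc v * s ≤ v * η := by gcongr
        _ ≤ r ^ 2 := h2
        _ ≤ s * s := by nlinarith
    have h4 : v ≤ s := le_of_mul_le_mul_right h3 hs0
    nlinarith

/-- Half the largest height `y` for which `r² ∫ dν(x) / (x² + y²)` still exceeds one. -/
def lowerScale (ν : Measure ℝ) (r : ℝ) : ℝ :=
  sSup {y : ℝ | 0 < y ∧ 1 < r ^ 2 * cauchyMean ν y} / 2

/-- The constant in the lower bound for the subordination function. -/
def lowerConst (ν : Measure ℝ) (r : ℝ) : ℝ :=
  min 1 (r ^ 2 / (∫ x, x ^ 2 ∂ν + (lowerScale ν r + r ^ 2 / lowerScale ν r) ^ 2))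

/-- Bounds the set in `lowerScale` by `r`, so that its `sSup` is a genuine supremum and not the
default value. -/
lemma le_of_one_lt_mul_cauchyMean [IsProbabilityMeasure ν] (hr : 0 < r) (hy : 0 < y)
    (h : 1 < r ^ 2 * cauchyMean ν y) : y ≤ r := by
  have h1 : r ^ 2 * cauchyMean ν y ≤ r ^ 2 * (y ^ 2)⁻¹ := by gcongr; exact cauchyMean_le hy
  have h2 := h.trans_le h1
  rw [← div_eq_mul_inv, one_lt_div (by positivity)] at h2
  exact (lt_of_pow_lt_pow_left₀ 2 hr.le h2).le

lemma lowerScale_pos [IsProbabilityMeasure ν] (hr : 0 < r)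
    (h : ∃ y, 0 < y ∧ 1 < r ^ 2 * cauchyMean ν y) : 0 < lowerScale ν r := by
  obtain ⟨y, hy, h⟩ := h
  exact half_pos (hy.trans_le (le_csSup
    ⟨r, fun t ht => le_of_one_lt_mul_cauchyMean hr ht.1 ht.2⟩ ⟨hy, h⟩))

lemma two_mul_lowerScale_le [IsProbabilityMeasure ν]
    (h : ∃ y, 0 < y ∧ 1 < r ^ 2 * cauchyMean ν y) (hy : 0 < y) (hy1 : r ^ 2 * cauchyMean ν y ≤ 1) :
    2 * lowerScale ν r ≤ y := by
  rw [lowerScale, mul_div_cancel₀ _ two_ne_zero]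
  refine csSup_le h fun t ht => ?_
  by_contra! hlt
  have := cauchyMean_anti (ν := ν) hy hlt.le
  have : r ^ 2 * cauchyMean ν t ≤ r ^ 2 * cauchyMean ν y := by gcongr
  linarith [ht.2]

lemma lowerConst_pos (hr : 0 < r) (hs : 0 < lowerScale ν r) : 0 < lowerConst ν r := by
  have : 0 ≤ ∫ x, x ^ 2 ∂ν := integral_nonneg fun x => by positivity
  rw [lowerConst]
  positivity

lemma le_of_real_solution [IsProbabilityMeasure ν] (hi : Integrable (fun x : ℝ => x ^ 2) ν)
    (hr : 0 < r) (he : ∃ y, 0 < y ∧ 1 < r ^ 2 * cauchyMean ν y) (hη : 0 < η) (hv : 0 < v)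
    (h : (v ^ 2 + r ^ 2) * ((η + v) * cauchyMean ν (η + v)) = v) :
    lowerScale ν r * lowerConst ν r * min 1 (lowerScale ν r / η) ≤ v := by
  have hs := lowerScale_pos hr he
  have hb := lowerConst_pos hr hs
  have hb1 : lowerConst ν r ≤ 1 := min_le_left _ _
  have hb2 : lowerConst ν r ≤
      r ^ 2 / (∫ x, x ^ 2 ∂ν + (lowerScale ν r + r ^ 2 / lowerScale ν r) ^ 2) := min_le_right _ _
  have hy : 0 < η + v := by positivity
  have hG := cauchyMean_pos hy hi
  have hJ := le_cauchyMean hy hi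
  have h2 := mul_le_sq_of_real_solution hη hv h
  have hR0 : 0 ≤ ∫ x, x ^ 2 ∂ν := integral_nonneg fun x => by positivity
  -- Dropping nonnegative terms from the equation leaves `r² g(η + v) ≤ 1`, so `η + v` lies above
  -- the threshold. The halving in `lowerScale` then gives `v ≥ s` whenever `η ≤ s`.
  have hsy : 2 * lowerScale ν r ≤ η + v := by
    refine two_mul_lowerScale_le he hy ?_
    have h3 : r ^ 2 * cauchyMean ν (η + v) * v ≤ 1 * v := by
      calc r ^ 2 * cauchyMean ν (η + v) * v ≤
            (v ^ 2 + r ^ 2) * ((η + v) * cauchyMean ν (η + v)) := by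
              have a1 : 0 ≤ v ^ 2 * ((η + v) * cauchyMean ν (η + v)) := by positivity
              have a2 : 0 ≤ r ^ 2 * (η * cauchyMean ν (η + v)) := by positivity
              linarith
        _ = 1 * v := by rw [h, one_mul]
    exact le_of_mul_le_mul_right h3 hv
  generalize lowerConst ν r = b at *
  generalize lowerScale ν r = s at *
  generalize ∫ x, x ^ 2 ∂ν = R at *
  rcases le_total η s with hηs | hηs
  · calc s * b * min 1 (s / η) ≤ s * 1 * 1 := by
          gcongr
          exact min_le_left _ _
      _ ≤ v := by linarith
  · have hvs : v ≤ r ^ 2 / s * (η / s) := by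
      have : v ≤ r ^ 2 / η := (le_div_iff₀ hη).2 h2
      refine this.trans ?_
      rw [div_mul_div_comm, div_le_div_iff₀ hη (by positivity)]
      have : s * s ≤ η * η := by gcongr
      nlinarith [sq_nonneg r]
    -- For `η ≥ s` the Jensen denominator grows at most like `(η/s)²`; its coefficient is the one in
    -- `lowerConst`.
    have hηs1 : 1 ≤ η / s := (one_le_div hs).2 hηs
    have hden : R + (η + v) ^ 2 ≤ (R + (s + r ^ 2 / s) ^ 2) * (η / s) ^ 2 := by
      have e1 : η + v ≤ (s + r ^ 2 / s) * (η / s) := by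
        have : s * (η / s) = η := by field_simp
        linarith
      have e2 : (η + v) ^ 2 ≤ ((s + r ^ 2 / s) * (η / s)) ^ 2 := by gcongr
      have e3 : R * 1 ≤ R * (η / s) ^ 2 := by
        gcongr
        exact one_le_pow₀ hηs1
      linarith [mul_pow (s + r ^ 2 / s) (η / s) 2]
    calc s * b * min 1 (s / η) ≤
          s * (r ^ 2 / (R + (s + r ^ 2 / s) ^ 2)) * (s / η) := by
          gcongr
          exact min_le_right _ _
      _ = r ^ 2 * (η * ((R + (s + r ^ 2 / s) ^ 2) * (η / s) ^ 2)⁻¹) := by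
          field_simp
      _ ≤ r ^ 2 * (η * (R + (η + v) ^ 2)⁻¹) := by gcongr
      _ ≤ (v ^ 2 + r ^ 2) * ((η + v) * cauchyMean ν (η + v)) := by
          gcongr
          · linarith [sq_nonneg v]
          · linarith
      _ = v := h

end Bounds

/-! ### The attracting fixed point at zero and continuity of `ω₂` -/

section Limit

variable {ν : Measure ℝ} {r s v y η : ℝ} {w₀ : ℂ}

lemma exists_cauchyMean_eq [IsProbabilityMeasure ν] (hi : Integrable (fun x : ℝ => x ^ 2) ν)
    (hs : ∀ᵐ x ∂ν, x ^ 2 ≤ s ^ 2) (hrR : r ^ 2 < ∫ x, x ^ 2 ∂ν)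
    (he : ∃ y, 0 < y ∧ 1 < r ^ 2 * cauchyMean ν y) :
    ∃ v, 0 < v ∧ (v ^ 2 + r ^ 2) * cauchyMean ν v = 1 := by
  obtain ⟨y, hy, he⟩ := he
  have hd : 0 < ∫ x, x ^ 2 ∂ν - r ^ 2 := sub_pos.2 hrR
  set R := ∫ x, x ^ 2 ∂ν with hR
  -- Chosen so that `V² (R - r²) ≥ r² s²`, which makes the chord bound at `V` at most one.
  set V := y + √(r ^ 2 * s ^ 2 / (R - r ^ 2)) with hV
  have hyV : y ≤ V := le_add_of_nonneg_right (Real.sqrt_nonneg _)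
  have hV0 : 0 < V := hy.trans_le hyV
  have hcont : ContinuousOn (fun t => (t ^ 2 + r ^ 2) * cauchyMean ν t) (Set.Icc y V) := by
    intro t ht
    have := continuousAt_cauchyMean (ν := ν) (hy.trans_le ht.1)
    exact ContinuousAt.continuousWithinAt (by fun_prop)
  have h1 : 1 ≤ (y ^ 2 + r ^ 2) * cauchyMean ν y := by
    have : 0 ≤ y ^ 2 * cauchyMean ν y := mul_nonneg (sq_nonneg y) (cauchyMean_pos hy hi).le
    linarith
  have h2 : (V ^ 2 + r ^ 2) * cauchyMean ν V ≤ 1 := by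
    have h3 : (V ^ 2 + r ^ 2) * cauchyMean ν V ≤
        (V ^ 2 + r ^ 2) * ((s ^ 2 + V ^ 2 - R) / (V ^ 2 * (s ^ 2 + V ^ 2))) := by
      gcongr
      exact cauchyMean_le_chord hV0 hi hs
    refine h3.trans ?_
    rw [mul_div_assoc', div_le_one (by positivity)]
    have h4 : r ^ 2 * s ^ 2 / (R - r ^ 2) ≤ V ^ 2 := by
      rw [← Real.sqrt_le_left hV0.le, hV]
      linarith
    rw [div_le_iff₀ hd] at h4
    have : 0 ≤ r ^ 2 * R := mul_nonneg (sq_nonneg r) (integral_nonneg fun x => by positivity)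
    nlinarith
  obtain ⟨v, hv, hv1⟩ := intermediate_value_Icc' hyV hcont ⟨h2, h1⟩
  exact ⟨v, hy.trans_le hv.1, hv1⟩

lemma nevanlinnaPart_I_mul_of_cauchyMean_eq [IsProbabilityMeasure ν]
    (hν : ν.map (fun x : ℝ => -x) = ν) (hv : 0 < v)
    (h : (v ^ 2 + r ^ 2) * cauchyMean ν v = 1) :
    nevanlinnaPart ν (Complex.I * v) = Complex.I * ((r ^ 2 / v : ℝ) : ℂ) := by
  have h1 : (v * cauchyMean ν v)⁻¹ - v = r ^ 2 / v := by
    rw [eq_inv_of_mul_eq_one_right h]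
    field_simp
    ring
  rw [nevanlinnaPart_I_mul hν hv, h1]

lemma subordinationMap_zero_I_mul [IsProbabilityMeasure ν]
    (hν : ν.map (fun x : ℝ => -x) = ν) (hv : 0 < v) (hr : 0 < r)
    (h : (v ^ 2 + r ^ 2) * cauchyMean ν v = 1) :
    subordinationMap ν r 0 (Complex.I * v) = Complex.I * v := by
  have hr0 : (r : ℂ) ≠ 0 := by exact_mod_cast hr.ne'
  have hv0 : (v : ℂ) ≠ 0 := by exact_mod_cast hv.ne'
  rw [subordinationMap, nevanlinnaPart_I_mul_of_cauchyMean_eq hν hv h]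
  rw [zero_add, zero_sub]
  push_cast
  field_simp
  linear_combination -Complex.I_sq

lemma centeredKernel_I_mul [IsProbabilityMeasure ν]
    (hν : ν.map (fun x : ℝ => -x) = ν) (hv : 0 < v)
    (h : (v ^ 2 + r ^ 2) * cauchyMean ν v = 1) (x : ℝ) :
    centeredKernel ν (Complex.I * v) x =
      (((r ^ 2 - x ^ 2) * (x ^ 2 + v ^ 2)⁻¹ : ℝ) : ℂ) -
        Complex.I * ((x * (x ^ 2 + v ^ 2)⁻¹ * ((v ^ 2 + r ^ 2) / v) : ℝ) : ℂ) := by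
  have hxv : ((x : ℂ) ^ 2 + (v : ℂ) ^ 2) ≠ 0 := by
    have : x ^ 2 + v ^ 2 ≠ 0 := by positivity
    exact_mod_cast this
  have hv0 : (v : ℂ) ≠ 0 := by exact_mod_cast hv.ne'
  have hc : cauchyMean ν v = (v ^ 2 + r ^ 2)⁻¹ := eq_inv_of_mul_eq_one_right h
  rw [centeredKernel, stieltjes_I_mul hν hv, inv_ofReal_sub_I_mul hv, hc, mul_inv, Complex.inv_I]
  push_cast
  rw [mul_inv, inv_inv]
  field_simp
  linear_combination (-(v : ℂ) * (v ^ 2 + r ^ 2)) * Complex.I_sq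

/-- With `k = A - iB`, oddness kills the cross term, so `∫ k² = ∫ A² - ∫ B²`, while the imaginary
part formula gives `∫ A² + ∫ B² = r²/v²`. Strictness needs both integrals positive: `A = 0` a.e.
means `x² = r²` a.e., and `B = 0` a.e. means `x = 0` a.e.; each contradicts `r² < R`. -/
lemma norm_integral_centeredKernel_sq_lt [IsProbabilityMeasure ν]
    (hν : ν.map (fun x : ℝ => -x) = ν) (hr : 0 < r) (hrR : r ^ 2 < ∫ x, x ^ 2 ∂ν) (hv : 0 < v)
    (h : (v ^ 2 + r ^ 2) * cauchyMean ν v = 1) :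
    ‖∫ x, centeredKernel ν (Complex.I * v) x * centeredKernel ν (Complex.I * v) x ∂ν‖ <
      r ^ 2 / v ^ 2 := by
  have him : (Complex.I * (v : ℂ)).im ≠ 0 := by simpa using hv.ne'
  set A : ℝ → ℝ := fun x => (r ^ 2 - x ^ 2) * (x ^ 2 + v ^ 2)⁻¹ with hA
  set B : ℝ → ℝ := fun x => x * (x ^ 2 + v ^ 2)⁻¹ * ((v ^ 2 + r ^ 2) / v) with hB
  have hK : ∀ x, centeredKernel ν (Complex.I * v) x = (A x : ℂ) - Complex.I * (B x : ℂ) :=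
    centeredKernel_I_mul hν hv h
  have hnorm : ∀ x, ‖centeredKernel ν (Complex.I * v) x‖ ^ 2 = A x ^ 2 + B x ^ 2 := fun x => by
    rw [hK, ← Complex.normSq_eq_norm_sq, Complex.normSq_apply]
    simp
    ring
  have hsum : Integrable (fun x => A x ^ 2 + B x ^ 2) ν := by
    simp_rw [← hnorm]
    exact (memLp_two_iff_integrable_sq_norm
      (measurable_centeredKernel ν _).aestronglyMeasurable).1 (memLp_centeredKernel him 2)
  have hAm : Measurable A := by fun_prop
  have hBm : Measurable B := by fun_prop
  have iA : Integrable (fun x => A x ^ 2) ν := hsum.mono' (hAm.pow_const 2).aestronglyMeasurable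
    (Eventually.of_forall fun x => by
      rw [Real.norm_of_nonneg (sq_nonneg _)]; linarith [sq_nonneg (B x)])
  have iB : Integrable (fun x => B x ^ 2) ν := hsum.mono' (hBm.pow_const 2).aestronglyMeasurable
    (Eventually.of_forall fun x => by
      rw [Real.norm_of_nonneg (sq_nonneg _)]; linarith [sq_nonneg (A x)])
  have hnp := nevanlinnaPart_im (ν := ν) him
  rw [nevanlinnaPart_I_mul_of_cauchyMean_eq hν hv h] at hnp
  simp_rw [hnorm] at hnp
  rw [integral_add iA iB] at hnp
  simp only [Complex.mul_im, Complex.I_re, Complex.I_im, Complex.ofReal_im, Complex.ofReal_re,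
    zero_mul, one_mul, zero_add] at hnp
  have hAB : ∫ x, A x ^ 2 ∂ν + ∫ x, B x ^ 2 ∂ν = r ^ 2 / v ^ 2 := by
    field_simp
    field_simp at hnp
    linarith
  have hA0 : 0 < ∫ x, A x ^ 2 ∂ν := by
    refine (integral_nonneg fun x => sq_nonneg _).lt_of_ne' fun h0 => ?_
    rw [integral_eq_zero_iff_of_nonneg (fun x => sq_nonneg _) iA] at h0
    have : ∫ x, x ^ 2 ∂ν = ∫ _x, r ^ 2 ∂ν := by
      refine integral_congr_ae ?_
      filter_upwards [h0] with x hx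
      have hxv : (x ^ 2 + v ^ 2)⁻¹ ≠ 0 := by positivity
      have := (mul_eq_zero.1 (pow_eq_zero_iff two_ne_zero |>.1 hx)).resolve_right hxv
      linarith
    simp [this] at hrR
  have hB0 : 0 < ∫ x, B x ^ 2 ∂ν := by
    refine (integral_nonneg fun x => sq_nonneg _).lt_of_ne' fun h0 => ?_
    rw [integral_eq_zero_iff_of_nonneg (fun x => sq_nonneg _) iB] at h0
    have : ∫ x, x ^ 2 ∂ν = ∫ _x, (0 : ℝ) ∂ν := by
      refine integral_congr_ae ?_
      filter_upwards [h0] with x hx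
      have hxv : (x ^ 2 + v ^ 2)⁻¹ ≠ 0 := by positivity
      have hc : (v ^ 2 + r ^ 2) / v ≠ 0 := by positivity
      have h1 := (mul_eq_zero.1 (pow_eq_zero_iff two_ne_zero |>.1 hx)).resolve_right hc
      simp [(mul_eq_zero.1 h1).resolve_right hxv]
    rw [this] at hrR
    simp only [integral_zero] at hrR
    nlinarith [sq_nonneg r]
  have hsq : ∫ x, centeredKernel ν (Complex.I * v) x * centeredKernel ν (Complex.I * v) x ∂ν =
      ((∫ x, A x ^ 2 ∂ν - ∫ x, B x ^ 2 ∂ν : ℝ) : ℂ) := by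
    have e : ∀ x, centeredKernel ν (Complex.I * v) x * centeredKernel ν (Complex.I * v) x =
        ((A x ^ 2 - B x ^ 2 : ℝ) : ℂ) - 2 * Complex.I * ((A x * B x : ℝ) : ℂ) := fun x => by
      rw [hK]
      push_cast
      linear_combination (B x : ℂ) ^ 2 * Complex.I_sq
    have iAB : Integrable (fun x => A x * B x) ν := hsum.mono' (hAm.mul hBm).aestronglyMeasurable
      (Eventually.of_forall fun x => by
        rw [Real.norm_eq_abs, abs_le]
        constructor <;> nlinarith [sq_nonneg (A x + B x), sq_nonneg (A x - B x)])
    have hodd : ∫ x, A x * B x ∂ν = 0 :=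
      integral_odd_eq_zero hν fun x => by simp only [hA, hB]; ring
    simp_rw [e]
    rw [integral_sub (iA.sub iB).ofReal (iAB.ofReal.const_mul _), integral_const_mul,
      integral_complex_ofReal, integral_complex_ofReal, hodd, integral_sub iA iB]
    simp
  rw [hsq, Complex.norm_real, Real.norm_eq_abs, abs_lt]
  constructor <;> linarith

lemma norm_inv_ofReal_sub_le_of_half_lt {w : ℂ} (h0 : 0 < w₀.im) (hw : w₀.im / 2 < w.im) (x : ℝ) :
    ‖((x : ℂ) - w)⁻¹‖ ≤ (w₀.im / 2)⁻¹ := by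
  have h1 : 0 < w.im := (half_pos h0).trans hw
  refine (norm_inv_ofReal_sub_le h1.ne' x).trans ?_
  rw [abs_of_pos h1]
  gcongr

lemma eventually_half_lt_im (h0 : 0 < w₀.im) : ∀ᶠ w in 𝓝 w₀, w₀.im / 2 < w.im :=
  Complex.continuous_im.continuousAt.eventually (lt_mem_nhds (half_lt_self h0))

lemma continuousAt_stieltjes [IsFiniteMeasure ν] (h0 : 0 < w₀.im) :
    ContinuousAt (stieltjes ν) w₀ := by
  refine continuousAt_of_dominated (bound := fun _ => (w₀.im / 2)⁻¹)
    (Eventually.of_forall fun w => (measurable_inv_ofReal_sub w).aestronglyMeasurable) ?_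
    (integrable_const _) (Eventually.of_forall fun x => ?_)
  · filter_upwards [eventually_half_lt_im h0] with w hw
    exact Eventually.of_forall (norm_inv_ofReal_sub_le_of_half_lt h0 hw)
  · have := ofReal_sub_ne_zero_of_im_ne_zero h0.ne' x
    fun_prop (disch := assumption)

lemma continuousAt_nevanlinnaPart [IsProbabilityMeasure ν] (h0 : 0 < w₀.im) :
    ContinuousAt (nevanlinnaPart ν) w₀ := by
  have h1 := continuousAt_stieltjes (ν := ν) h0
  have h2 := stieltjes_ne_zero (ν := ν) h0.ne'
  unfold nevanlinnaPart negRecipStieltjes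
  fun_prop (disch := assumption)

lemma continuousAt_integral_centeredKernel_mul [IsProbabilityMeasure ν] (h0 : 0 < w₀.im) :
    ContinuousAt (fun p : ℂ × ℂ => ∫ x, centeredKernel ν p.1 x * centeredKernel ν p.2 x ∂ν)
      (w₀, w₀) := by
  have e1 : ∀ᶠ p : ℂ × ℂ in 𝓝 (w₀, w₀), w₀.im / 2 < p.1.im :=
    continuousAt_fst.eventually (eventually_half_lt_im h0)
  have e2 : ∀ᶠ p : ℂ × ℂ in 𝓝 (w₀, w₀), w₀.im / 2 < p.2.im :=
    continuousAt_snd.eventually (eventually_half_lt_im h0)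
  have hJ : ContinuousAt (fun p : ℂ × ℂ =>
      ∫ x : ℝ, ((x : ℂ) - p.1)⁻¹ * ((x : ℂ) - p.2)⁻¹ ∂ν) (w₀, w₀) := by
    refine continuousAt_of_dominated (bound := fun _ => (w₀.im / 2)⁻¹ * (w₀.im / 2)⁻¹)
      (Eventually.of_forall fun p => ((measurable_inv_ofReal_sub p.1).mul
        (measurable_inv_ofReal_sub p.2)).aestronglyMeasurable) ?_
      (integrable_const _) (Eventually.of_forall fun x => ?_)
    · filter_upwards [e1, e2] with p h1 h2
      refine Eventually.of_forall fun x => ?_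
      rw [norm_mul]
      exact mul_le_mul (norm_inv_ofReal_sub_le_of_half_lt h0 h1 x)
        (norm_inv_ofReal_sub_le_of_half_lt h0 h2 x) (norm_nonneg _) (by positivity)
    · have hx : (x : ℂ) - w₀ ≠ 0 := ofReal_sub_ne_zero_of_im_ne_zero h0.ne' x
      have c1 : ContinuousAt (fun p : ℂ × ℂ => ((x : ℂ) - p.1)⁻¹) (w₀, w₀) :=
        ContinuousAt.inv₀ (by fun_prop) hx
      have c2 : ContinuousAt (fun p : ℂ × ℂ => ((x : ℂ) - p.2)⁻¹) (w₀, w₀) :=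
        ContinuousAt.inv₀ (by fun_prop) hx
      exact c1.mul c2
  have hS := continuousAt_stieltjes (ν := ν) h0
  have hS0 := stieltjes_ne_zero (ν := ν) h0.ne'
  have hS1 : ContinuousAt (fun p : ℂ × ℂ => (stieltjes ν p.1)⁻¹) (w₀, w₀) :=
    ContinuousAt.inv₀ (ContinuousAt.comp_of_eq hS (continuousAt_fst (p := (w₀, w₀))) rfl :) hS0
  have hS2 : ContinuousAt (fun p : ℂ × ℂ => (stieltjes ν p.2)⁻¹) (w₀, w₀) :=
    ContinuousAt.inv₀ (ContinuousAt.comp_of_eq hS (continuousAt_snd (p := (w₀, w₀))) rfl :) hS0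
  refine (((hS1.mul hS2).mul hJ).sub (continuousAt_const (y := (1 : ℂ)))).congr ?_
  filter_upwards [e1, e2] with p h1 h2
  exact (integral_centeredKernel_mul ((half_pos h0).trans h1).ne'
    ((half_pos h0).trans h2).ne').symm

/-- Near an attracting fixed point of `subordinationMap ν r 0` the maps `subordinationMap ν r z`
are uniformly contracting. -/
lemma exists_contraction_near [IsProbabilityMeasure ν] (h0 : 0 < w₀.im)
    (hh : nevanlinnaPart ν w₀ ≠ 0)
    (hK : r ^ 2 * ‖∫ x, centeredKernel ν w₀ x * centeredKernel ν w₀ x ∂ν‖ <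
      ‖nevanlinnaPart ν w₀‖ ^ 2) :
    ∃ c : ℝ, 0 ≤ c ∧ c < 1 ∧ ∃ δ > 0, ∀ z ∈ Metric.ball (0 : ℂ) δ, ∀ w ∈ Metric.ball w₀ δ,
      ∀ w' ∈ Metric.ball w₀ δ, 0 < w.im ∧
        ‖subordinationMap ν r z w - subordinationMap ν r z w'‖ ≤ c * ‖w - w'‖ := by
  have hc := continuousAt_nevanlinnaPart (ν := ν) h0
  let a : ℂ × ℂ × ℂ → ℂ := fun p => p.1 + nevanlinnaPart ν p.2.1
  let a' : ℂ × ℂ × ℂ → ℂ := fun p => p.1 + nevanlinnaPart ν p.2.2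
  -- The difference quotient of `T_z`, extended continuously across `w = w'`; at `(0, w₀, w₀)` it is
  -- the derivative of `T_0`, of modulus below one by `hK`.
  let q : ℂ × ℂ × ℂ → ℂ := fun p =>
    (r : ℂ) ^ 2 * (∫ x, centeredKernel ν p.2.1 x * centeredKernel ν p.2.2 x ∂ν) / (a p * a' p)
  have ca : ContinuousAt a (0, w₀, w₀) := continuousAt_fst.add
    (ContinuousAt.comp_of_eq hc (by fun_prop : ContinuousAt
      (fun p : ℂ × ℂ × ℂ => p.2.1) (0, w₀, w₀)) rfl :)
  have ca' : ContinuousAt a' (0, w₀, w₀) := continuousAt_fst.add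
    (ContinuousAt.comp_of_eq hc (by fun_prop : ContinuousAt
      (fun p : ℂ × ℂ × ℂ => p.2.2) (0, w₀, w₀)) rfl :)
  have ha : a (0, w₀, w₀) ≠ 0 := by simpa [a] using hh
  have ha' : a' (0, w₀, w₀) ≠ 0 := by simpa [a'] using hh
  have cq : ContinuousAt q (0, w₀, w₀) := by
    refine ContinuousAt.div (continuousAt_const.mul ?_) (ca.mul ca') (mul_ne_zero ha ha')
    exact (ContinuousAt.comp_of_eq (continuousAt_integral_centeredKernel_mul (ν := ν) h0)
      (continuousAt_snd (p := ((0 : ℂ), w₀, w₀))) rfl :)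
  have hq : ‖q (0, w₀, w₀)‖ < 1 := by
    have hp : 0 < ‖nevanlinnaPart ν w₀‖ := norm_pos_iff.2 hh
    simp only [q, a, a', zero_add, norm_div, norm_mul, norm_pow, Complex.norm_real,
      Real.norm_eq_abs, sq_abs]
    rw [div_lt_one (by positivity), ← sq]
    exact hK
  obtain ⟨c, hc1, hc2⟩ := exists_between hq
  have hev := (cq.norm.eventually (gt_mem_nhds hc1)).and ((ca.eventually_ne ha).and
    ((ca'.eventually_ne ha').and
      ((continuousAt_snd.fst.eventually (eventually_half_lt_im h0)).and
        (continuousAt_snd.snd.eventually (eventually_half_lt_im h0)))))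
  obtain ⟨δ, hδ, hball⟩ := Metric.eventually_nhds_iff_ball.1 hev
  refine ⟨c, (norm_nonneg _).trans hc1.le, hc2, δ, hδ, fun z hz w hw w' hw' => ?_⟩
  obtain ⟨b1, b2, b3, b4, b5⟩ := hball (z, w, w') (by
    rw [← ball_prod_same, ← ball_prod_same]
    exact ⟨hz, hw, hw'⟩)
  have p1 : 0 < w.im := (half_pos h0).trans b4
  have p2 : 0 < w'.im := (half_pos h0).trans b5
  refine ⟨p1, ?_⟩
  rw [subordinationMap_sub p1.ne' p2.ne' b2 b3, norm_mul]
  exact mul_le_mul_of_nonneg_right b1.le (norm_nonneg _)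

lemma continuousAt_subordinationMap_zero (hh : nevanlinnaPart ν w₀ ≠ 0) :
    ContinuousAt (fun z => subordinationMap ν r z w₀) 0 := by
  have : (0 : ℂ) + nevanlinnaPart ν w₀ ≠ 0 := by simpa using hh
  unfold subordinationMap
  fun_prop (disch := assumption)

/-- A strictly attracting fixed point of the limiting map persists. -/
lemma eventually_exists_fixedPoint [IsProbabilityMeasure ν] (h0 : 0 < w₀.im)
    (hh : nevanlinnaPart ν w₀ ≠ 0)
    (hK : r ^ 2 * ‖∫ x, centeredKernel ν w₀ x * centeredKernel ν w₀ x ∂ν‖ <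
      ‖nevanlinnaPart ν w₀‖ ^ 2)
    (hfix : subordinationMap ν r 0 w₀ = w₀) {ε : ℝ} (hε : 0 < ε) :
    ∀ᶠ z in 𝓝 (0 : ℂ), ∃ w, 0 < w.im ∧ dist w w₀ < ε ∧ subordinationMap ν r z w = w := by
  obtain ⟨c, hc0, hc1, δ, hδ, hcon⟩ := exists_contraction_near h0 hh hK
  set ρ := min ε δ / 2 with hρ
  have hm : 0 < min ε δ := lt_min hε hδ
  have hρ0 : 0 < ρ := half_pos hm
  have hρm : ρ < min ε δ := half_lt_self hm
  have hsub : Metric.closedBall w₀ ρ ⊆ Metric.ball w₀ δ :=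
    Metric.closedBall_subset_ball (hρm.trans_le (min_le_right _ _))
  have hw₀ : w₀ ∈ Metric.closedBall w₀ ρ := Metric.mem_closedBall_self hρ0.le
  have hcont := continuousAt_subordinationMap_zero (r := r) hh
  -- Moving the center by less than `(1 - c)ρ` lets a `c`-contraction map the closed `ρ`-ball into
  -- itself, so Banach's theorem applies.
  have hev : ∀ᶠ z in 𝓝 (0 : ℂ), dist (subordinationMap ν r z w₀) w₀ < (1 - c) * ρ := by
    have := Metric.tendsto_nhds.1 hcont ((1 - c) * ρ) (mul_pos (sub_pos.2 hc1) hρ0)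
    simpa only [hfix] using this
  filter_upwards [hev, Metric.ball_mem_nhds (0 : ℂ) hδ] with z hz hzδ
  have hmaps : Set.MapsTo (subordinationMap ν r z) (Metric.closedBall w₀ ρ)
      (Metric.closedBall w₀ ρ) := fun w hw => by
    have h1 := (hcon z hzδ w (hsub hw) w₀ (hsub hw₀)).2
    rw [← dist_eq_norm, ← dist_eq_norm] at h1
    have h2 := dist_triangle (subordinationMap ν r z w) (subordinationMap ν r z w₀) w₀
    have h3 : c * dist w w₀ ≤ c * ρ := by gcongr; exact hw
    rw [Metric.mem_closedBall]
    linarith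
  have hcontr : ContractingWith ⟨c, hc0⟩ (hmaps.restrict _ _ _) := by
    refine ⟨by exact_mod_cast hc1, LipschitzWith.of_dist_le_mul fun p p' => ?_⟩
    have := (hcon z hzδ p (hsub p.2) p' (hsub p'.2)).2
    rwa [← dist_eq_norm, ← dist_eq_norm] at this
  obtain ⟨w, hw, hwfix, -⟩ := hcontr.exists_fixedPoint' Metric.isClosed_closedBall.isComplete
    hmaps hw₀ (edist_ne_top _ _)
  exact ⟨w, (hcon z hzδ w (hsub hw) w (hsub hw)).1,
    (Metric.mem_closedBall.1 hw).trans_lt (hρm.trans_le (min_le_left _ _)), hwfix⟩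

lemma IsSubordinationPair.tendsto_zero [IsProbabilityMeasure ν] {ω₁ ω₂ : ℂ → ℂ}
    (hν : ν.map (fun x : ℝ => -x) = ν) (hr : 0 < r) (hrR : r ^ 2 < ∫ x, x ^ 2 ∂ν)
    (h : IsSubordinationPair ν (symmetrization (Measure.dirac r)) ω₁ ω₂) (hv : 0 < v)
    (hv1 : (v ^ 2 + r ^ 2) * cauchyMean ν v = 1) :
    Tendsto ω₂ (𝓝[upperHalf] 0) (𝓝 (Complex.I * v)) := by
  have h0 : 0 < (Complex.I * (v : ℂ)).im := by simpa using hv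
  have hn := nevanlinnaPart_I_mul_of_cauchyMean_eq hν hv hv1
  have hnorm : ‖nevanlinnaPart ν (Complex.I * v)‖ = r ^ 2 / v := by
    rw [hn, norm_mul, Complex.norm_I, one_mul, Complex.norm_real, Real.norm_of_nonneg
      (by positivity)]
  have hh : nevanlinnaPart ν (Complex.I * v) ≠ 0 := by
    rw [← norm_pos_iff, hnorm]
    positivity
  have hK : r ^ 2 * ‖∫ x, centeredKernel ν (Complex.I * v) x *
      centeredKernel ν (Complex.I * v) x ∂ν‖ < ‖nevanlinnaPart ν (Complex.I * v)‖ ^ 2 := by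
    rw [hnorm]
    calc _ < r ^ 2 * (r ^ 2 / v ^ 2) := by
          gcongr
          exact norm_integral_centeredKernel_sq_lt hν hr hrR hv hv1
      _ = _ := by ring
  rw [Metric.tendsto_nhds]
  intro ε hε
  have hev := eventually_exists_fixedPoint h0 hh hK (subordinationMap_zero_I_mul hν hv hr hv1) hε
  filter_upwards [nhdsWithin_le_nhds hev, self_mem_nhdsWithin] with z ⟨w, hw, hd, hwfix⟩ hz
  rwa [eq_of_subordinationMap_eq hr hz (h.mapsTo₂ hz) hw (h.subordinationMap_eq hz) hwfix]

end Limit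

/-! ### Symmetrization and the radii -/

section Symmetrization

variable {μ : Measure ℝ} {r s : ℝ}

instance isProbabilityMeasure_symmetrization [IsProbabilityMeasure μ] :
    IsProbabilityMeasure (symmetrization μ) := by
  refine ⟨?_⟩
  rw [symmetrization, Measure.smul_apply, Measure.add_apply, Measure.map_apply measurable_neg
    MeasurableSet.univ, Set.preimage_univ, measure_univ, smul_eq_mul, one_add_one_eq_two]
  exact ENNReal.inv_mul_cancel two_ne_zero ENNReal.ofNat_ne_top

lemma map_neg_symmetrization (μ : Measure ℝ) :
    (symmetrization μ).map (fun x : ℝ => -x) = symmetrization μ := by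
  have hm : Measurable fun x : ℝ => -x := measurable_neg
  rw [symmetrization, Measure.map_smul, Measure.map_add _ _ hm, Measure.map_map hm hm]
  have : ((fun x : ℝ => -x) ∘ fun x : ℝ => -x) = id := by ext; simp
  rw [this, Measure.map_id, add_comm]

lemma integrable_symmetrization_of_even {f : ℝ → ℝ} (hf : ∀ x, f (-x) = f x)
    (hi : Integrable f μ) : Integrable f (symmetrization μ) := by
  refine Integrable.smul_measure (hi.add_measure ?_) (by simp)
  refine (integrable_map_equiv (MeasurableEquiv.neg ℝ) f).2 (hi.congr ?_)
  exact Eventually.of_forall fun x => (hf x).symm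

lemma integral_symmetrization_of_even {f : ℝ → ℝ} (hf : ∀ x, f (-x) = f x)
    (hi : Integrable f μ) : ∫ x, f x ∂(symmetrization μ) = ∫ x, f x ∂μ := by
  have hmap : ∫ x, f x ∂(μ.map fun x : ℝ => -x) = ∫ x, f x ∂μ :=
    (integral_map_equiv (MeasurableEquiv.neg ℝ) f).trans (by simp [hf])
  have hi' : Integrable f (μ.map fun x : ℝ => -x) :=
    (integrable_map_equiv (MeasurableEquiv.neg ℝ) f).2
      (hi.congr (Eventually.of_forall fun x => (hf x).symm))
  rw [symmetrization, integral_smul_measure, integral_add_measure hi hi', hmap]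
  simp only [ENNReal.toReal_inv, ENNReal.toReal_ofNat, smul_eq_mul]
  ring

lemma ae_sq_le_of_support_subset (h : μ.support ⊆ Set.Icc 0 s) : ∀ᵐ x ∂μ, x ^ 2 ≤ s ^ 2 := by
  filter_upwards [Measure.support_mem_ae (μ := μ)] with x hx
  obtain ⟨h0, h1⟩ := h hx
  gcongr

lemma integrable_sq_of_ae_le [IsFiniteMeasure μ] (h : ∀ᵐ x ∂μ, x ^ 2 ≤ s ^ 2) :
    Integrable (fun x : ℝ => x ^ 2) μ := by
  refine Integrable.of_bound (by fun_prop) (s ^ 2) ?_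
  filter_upwards [h] with x hx
  rwa [Real.norm_of_nonneg (sq_nonneg x)]

lemma ae_symmetrization_sq_le (h : ∀ᵐ x ∂μ, x ^ 2 ≤ s ^ 2) :
    ∀ᵐ x ∂(symmetrization μ), x ^ 2 ≤ s ^ 2 := by
  refine Measure.ae_smul_measure ?_ _
  rw [ae_add_measure_iff]
  refine ⟨h, ?_⟩
  rw [ae_map_iff measurable_neg.aemeasurable (measurableSet_le (by fun_prop) (by fun_prop))]
  simpa using h

lemma cauchyMean_symmetrization [IsFiniteMeasure μ] {y : ℝ} (hy : 0 < y) :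
    cauchyMean (symmetrization μ) y = cauchyMean μ y :=
  integral_symmetrization_of_even (by simp) (integrable_inv_sq_add_sq hy)

lemma rMinus_nonneg (μ : Measure ℝ) : 0 ≤ rMinus μ := Real.sqrt_nonneg _

lemma ofReal_cauchyMean [IsFiniteMeasure μ] {y : ℝ} (hy : 0 < y) :
    ENNReal.ofReal (cauchyMean μ y) = ∫⁻ x, (ENNReal.ofReal (x ^ 2 + y ^ 2))⁻¹ ∂μ := by
  rw [cauchyMean, ofReal_integral_eq_lintegral_ofReal (integrable_inv_sq_add_sq hy)
    (Eventually.of_forall fun x => by positivity)]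
  congr 1 with x
  exact ENNReal.ofReal_inv_of_pos (by positivity)

/-- Monotone convergence in `[0, ∞]`, which also covers a divergent inverse second moment. -/
lemma tendsto_ofReal_cauchyMean (μ : Measure ℝ) [IsFiniteMeasure μ] :
    Tendsto (fun n : ℕ => ENNReal.ofReal (cauchyMean μ (1 / ((n : ℝ) + 1)))) atTop
      (𝓝 (∫⁻ x, (ENNReal.ofReal (x ^ 2))⁻¹ ∂μ)) := by
  simp_rw [fun n : ℕ => ofReal_cauchyMean (μ := μ) (Nat.one_div_pos_of_nat (α := ℝ) (n := n))]
  refine lintegral_tendsto_of_tendsto_of_monotone (fun n => by fun_prop)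
    (Eventually.of_forall fun x m n hmn => ?_) (Eventually.of_forall fun x => ?_)
  · have := Nat.one_div_le_one_div (α := ℝ) hmn
    dsimp only
    gcongr
  · refine tendsto_inv_iff.2 (ENNReal.tendsto_ofReal ?_)
    simpa using (tendsto_one_div_add_atTop_nhds_zero_nat (𝕜 := ℝ)).pow 2 |>.const_add (x ^ 2)

/-- Above the inner radius the integral `r² ∫ dμ(x) / (x² + y²)` exceeds one for small `y`. -/
lemma exists_one_lt_mul_cauchyMean [IsProbabilityMeasure μ] (hr : rMinus μ < r) :
    ∃ y, 0 < y ∧ 1 < r ^ 2 * cauchyMean μ y := by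
  have hr0 : 0 < r := (rMinus_nonneg μ).trans_lt hr
  set I := ∫⁻ x, (ENNReal.ofReal (x ^ 2))⁻¹ ∂μ with hI
  -- Excludes `I⁻¹ = ∞`, which `toReal` in `rMinus` would send to `0`.
  have hI0 : I ≠ 0 := by
    rw [hI, Ne, lintegral_eq_zero_iff (by fun_prop)]
    intro h
    have : ∀ᵐ _x ∂μ, False := h.mono fun x hx => by simp at hx
    simp only [eventually_false_iff_eq_bot, ae_eq_bot] at this
    exact IsProbabilityMeasure.ne_zero μ this
  have hlt : I⁻¹ < ENNReal.ofReal (r ^ 2) := by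
    rw [ENNReal.lt_ofReal_iff_toReal_lt (ENNReal.inv_ne_top.2 hI0)]
    exact (Real.sqrt_lt' hr0).1 hr
  have hlt' : ENNReal.ofReal ((r ^ 2)⁻¹) < I := by
    rw [ENNReal.ofReal_inv_of_pos (by positivity)]
    exact ENNReal.inv_lt_iff_inv_lt.1 hlt
  obtain ⟨n, hn⟩ := ((tendsto_ofReal_cauchyMean μ).eventually (lt_mem_nhds hlt')).exists
  refine ⟨_, Nat.one_div_pos_of_nat (n := n), ?_⟩
  have h1 := (ENNReal.ofReal_lt_ofReal_iff_of_nonneg (by positivity)).1 hn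
  rwa [inv_lt_iff_one_lt_mul₀' (by positivity)] at h1

lemma sq_lt_integral_of_lt_rPlus (hr0 : 0 ≤ r) (hr : r < rPlus μ) : r ^ 2 < ∫ x, x ^ 2 ∂μ :=
  (Real.lt_sqrt hr0).1 hr

lemma rPlus_sq (μ : Measure ℝ) : rPlus μ ^ 2 = ∫ x, x ^ 2 ∂μ :=
  Real.sq_sqrt (integral_nonneg fun x => sq_nonneg x)

lemma sq_mem_Ioo (hr : r ∈ Set.Ioo (rMinus μ) (rPlus μ)) :
    r ^ 2 ∈ Set.Ioo (rMinus μ ^ 2) (rPlus μ ^ 2) :=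
  ⟨pow_lt_pow_left₀ hr.1 (rMinus_nonneg μ) two_ne_zero,
    pow_lt_pow_left₀ hr.2 ((rMinus_nonneg μ).trans hr.1.le) two_ne_zero⟩

lemma sigmaMinus_pos (hr : r ∈ Set.Ioo (rMinus μ) (rPlus μ)) : 0 < sigmaMinus μ r := by
  obtain ⟨h1, h2⟩ := sq_mem_Ioo hr
  exact Real.sqrt_pos.2 (div_pos (by linarith) (by linarith))

lemma sigmaMinus_le_one (hr : r ∈ Set.Ioo (rMinus μ) (rPlus μ)) : sigmaMinus μ r ≤ 1 := by
  obtain ⟨h1, h2⟩ := sq_mem_Ioo hr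
  rw [sigmaMinus, Real.sqrt_le_left zero_le_one, one_pow, div_le_one (by linarith)]
  linarith

end Symmetrization

/-! ### Assembly of the bounds and passage to zero -/

/-- Bounds for the solution of the subordination equation on the imaginary axis. -/
lemma IsSubordinationPair.norm_sub_bounds {μ : Measure ℝ} [IsProbabilityMeasure μ] {r s η : ℝ}
    {ω₁ ω₂ : ℂ → ℂ} (hs0 : 0 < s) (hs : ∀ᵐ x ∂μ, x ^ 2 ≤ s ^ 2)
    (hr : r ∈ Set.Ioo (rMinus μ) (rPlus μ))
    (h : IsSubordinationPair (symmetrization μ) (symmetrization (Measure.dirac r)) ω₁ ω₂)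
    (hη : 0 < η) :
    2⁻¹ * (sigmaMinus μ r * lowerScale (symmetrization μ) r * lowerConst (symmetrization μ) r) *
        min 1 (sigmaMinus μ r * lowerScale (symmetrization μ) r / η) ≤
      ‖ω₂ (Complex.I * η) - Complex.I * η‖ ∧
    ‖ω₂ (Complex.I * η) - Complex.I * η‖ ≤ 2 * min (sigmaPlus μ r * s) (r ^ 2 / η) := by
  have hr0 : 0 < r := (rMinus_nonneg μ).trans_lt hr.1
  have hi := integrable_sq_of_ae_le hs
  have hi' := integrable_symmetrization_of_even (fun x => neg_sq x) hi
  have hs' := ae_symmetrization_sq_le hs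
  have hR := integral_symmetrization_of_even (fun x => neg_sq x) hi
  have hrR : r ^ 2 < ∫ x, x ^ 2 ∂(symmetrization μ) := by
    rw [hR]
    exact sq_lt_integral_of_lt_rPlus hr0.le hr.2
  have he : ∃ y, 0 < y ∧ 1 < r ^ 2 * cauchyMean (symmetrization μ) y := by
    obtain ⟨y, hy, h1⟩ := exists_one_lt_mul_cauchyMean hr.1
    exact ⟨y, hy, by rwa [cauchyMean_symmetrization hy]⟩
  obtain ⟨v, hv, hω, hv1⟩ := h.exists_real_solution (map_neg_symmetrization μ) hi' hr0 hη
  have hnorm : ‖ω₂ (Complex.I * η) - Complex.I * η‖ = v := by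
    rw [hω, add_sub_cancel_left, norm_mul, Complex.norm_I, one_mul, Complex.norm_real,
      Real.norm_of_nonneg hv.le]
  rw [hnorm]
  constructor
  · have hlow := le_of_real_solution hi' hr0 he hη hv hv1
    have hc := lowerScale_pos hr0 he
    have hb := lowerConst_pos hr0 hc
    have hσ := sigmaMinus_le_one hr
    have hσ0 : 0 ≤ sigmaMinus μ r := Real.sqrt_nonneg _
    refine le_trans ?_ hlow
    generalize sigmaMinus μ r = σ at *
    generalize lowerConst (symmetrization μ) r = b at *
    generalize lowerScale (symmetrization μ) r = c at *
    -- The bound already holds without `σ₋`; since `σ₋ ≤ 1`, inserting it only weakens the estimate.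
    have h1 : σ * c ≤ c := mul_le_of_le_one_left hc.le hσ
    have h2 : 2⁻¹ * (σ * c * b) ≤ c * b := by
      have h3 : σ * c * b ≤ c * b := by gcongr
      have : 0 ≤ σ * c * b := by positivity
      linarith
    gcongr
  · rw [mul_min_of_nonneg _ _ zero_le_two, le_min_iff]
    constructor
    · have := le_two_mul_of_real_solution hi' hs' hs0 hrR hη hv hv1
      rwa [hR, ← rPlus_sq] at this
    · have h1 : v ≤ r ^ 2 / η := (le_div_iff₀ hη).2 (mul_le_sq_of_real_solution hη hv hv1)
      have : 0 ≤ r ^ 2 / η := by positivity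
      linarith

lemma tendsto_I_mul_nhdsGT_zero :
    Tendsto (fun η : ℝ => Complex.I * (η : ℂ)) (𝓝[>] 0) (𝓝[upperHalf] 0) := by
  refine tendsto_nhdsWithin_iff.2 ⟨?_, ?_⟩
  · have : Continuous fun η : ℝ => Complex.I * (η : ℂ) := by fun_prop
    simpa using (this.tendsto 0).mono_left nhdsWithin_le_nhds
  · filter_upwards [self_mem_nhdsWithin] with η hη
    simpa [upperHalf] using hη

end

theorem mainTheorem8 :
    ∃ C₂ : ℝ, 1 < C₂ ∧
      ∃ bMinus sMinus : Measure ℝ → ℝ → ℝ,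
        ∀ (μσ : Measure ℝ) [IsProbabilityMeasure μσ] (sPlus : ℝ), 0 < sPlus →
          μσ.support ⊆ Set.Icc 0 sPlus → μσ.support.Nontrivial →
          ∀ r ∈ Set.Ioo (rMinus μσ) (rPlus μσ),
            0 < bMinus (symmetrization μσ) r ∧ 0 < sMinus (symmetrization μσ) r ∧
            ∀ ω₁ ω₂ : ℂ → ℂ,
              IsSubordinationPair (symmetrization μσ) (symmetrization (Measure.dirac r)) ω₁ ω₂ →
              -- `ω₂` extends continuously to `0`; this is the case `η = 0`, with `c / 0 = ∞`
              (∃ w₀ : ℂ, Tendsto ω₂ (𝓝[upperHalf] 0) (𝓝 w₀) ∧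
                C₂⁻¹ * (sigmaMinus μσ r * sMinus (symmetrization μσ) r *
                  bMinus (symmetrization μσ) r) ≤ ‖w₀‖ ∧
                ‖w₀‖ ≤ C₂ * (sigmaPlus μσ r * sPlus)) ∧
              -- the case `η > 0`
              ∀ η : ℝ, 0 < η →
                C₂⁻¹ * (sigmaMinus μσ r * sMinus (symmetrization μσ) r *
                  bMinus (symmetrization μσ) r) *
                    min 1 (sigmaMinus μσ r * sMinus (symmetrization μσ) r / η) ≤
                  ‖ω₂ (Complex.I * η) - Complex.I * η‖ ∧
                ‖ω₂ (Complex.I * η) - Complex.I * η‖ ≤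
                  C₂ * min (sigmaPlus μσ r * sPlus) (r ^ 2 / η) := by
  refine ⟨2, one_lt_two, lowerConst, lowerScale, ?_⟩
  intro μσ _ sPlus hs0 hsupp _ r hr
  have hs := ae_sq_le_of_support_subset hsupp
  have hr0 : 0 < r := (rMinus_nonneg μσ).trans_lt hr.1
  have hi := integrable_sq_of_ae_le hs
  have hi' := integrable_symmetrization_of_even (fun x => neg_sq x) hi
  have hrR : r ^ 2 < ∫ x, x ^ 2 ∂(symmetrization μσ) := by
    rw [integral_symmetrization_of_even (fun x => neg_sq x) hi]
    exact sq_lt_integral_of_lt_rPlus hr0.le hr.2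
  have he : ∃ y, 0 < y ∧ 1 < r ^ 2 * cauchyMean (symmetrization μσ) y := by
    obtain ⟨y, hy, h1⟩ := exists_one_lt_mul_cauchyMean hr.1
    exact ⟨y, hy, by rwa [cauchyMean_symmetrization hy]⟩
  have hc := lowerScale_pos hr0 he
  refine ⟨lowerConst_pos hr0 hc, hc, fun ω₁ ω₂ h => ⟨?_, fun η hη =>
    h.norm_sub_bounds hs0 hs hr hη⟩⟩
  obtain ⟨v, hv, hv1⟩ := exists_cauchyMean_eq hi' (ae_symmetrization_sq_le hs) hrR he
  have hlim := h.tendsto_zero (map_neg_symmetrization μσ) hr0 hrR hv hv1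
  refine ⟨_, hlim, ?_⟩
  have hI := tendsto_I_mul_nhdsGT_zero
  have hnorm : Tendsto (fun η : ℝ => ‖ω₂ (Complex.I * η) - Complex.I * η‖) (𝓝[>] 0)
      (𝓝 ‖Complex.I * (v : ℂ)‖) := by
    simpa using ((hlim.comp hI).sub (hI.mono_right nhdsWithin_le_nhds)).norm
  have hσ := sigmaMinus_pos hr
  constructor
  · refine ge_of_tendsto hnorm ?_
    -- For `η ≤ σ₋ s₋` the minimum equals one, so the lower bound no longer depends on `η`.
    filter_upwards [Ioc_mem_nhdsGT (mul_pos hσ hc)] with η hη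
    have h1 := (h.norm_sub_bounds hs0 hs hr hη.1).1
    rwa [min_eq_left ((one_le_div hη.1).2 hη.2), mul_one] at h1
  · refine le_of_tendsto hnorm ?_
    filter_upwards [self_mem_nhdsWithin] with η hη
    refine (h.norm_sub_bounds hs0 hs hr hη).2.trans ?_
    gcongr
    exact min_le_left _ _
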